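/- Let $\Omega\subset\mathbb R^2$ be an open set with $\sigma_1\Omega=\Omega$ and $\sigma_2\Omega=\Omega$, where $\sigma_1(x,y)=(-x,y)$ and $\sigma_2(x,y)=(x,-y)$, and let $\dot\Omega=\Omega\setminus\{0\}$. Write $x+iy=re^{i\theta}$, $\mathbf A=(A_1,A_2)=\frac12\left(-\frac{y}{r^2},\frac{x}{r^2}\right)$, $D=-i\partial$, and let $-\Delta_{\mathbf A}$ be the Aharonov–Bohm operator in $L^2(\dot\Omega;\mathbb C)$, that is, the Friedrichs extension of the differential operator $(D_x-A_1)^2+(D_y-A_2)^2$ with domain $C_0^\infty(\dot\Omega)$. Let $\Gamma u=\bar u$, $\Sigma_ju=u\circ\sigma_j$ for $j=1,2$, $K=e^{i\theta}\,\Gamma$, $\Sigma_1^c=i\,\Gamma\Sigma_1$, $\Sigma_2^c=\Gamma\Sigma_2$, and consider the real Hilbert spaces $L^2_K=\{u\in L^2(\dot\Omega): Ku=u\}$ and, for $j=1,2$, $$L^2_{K,\Sigma_j}=\{u\in L^2_K:\Sigma_j^cu=u\},\qquad L^2_{K,a\Sigma_j}=\{u\in L^2_K:\Sigma_j^cu=-u\}.$$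 Let $V$ be any of the four spaces $L^2_{K,\Sigma_1}$, $L^2_{K,a\Sigma_1}$, $L^2_{K,\Sigma_2}$, $L^2_{K,a\Sigma_2}$. Then $-\Delta_{\mathbf A}$ maps $D(-\Delta_{\mathbf A})\cap V$ into $V$, and its restriction $-\Delta_{\mathbf A,V}$ to $V$, an operator in the real Hilbert space $V$ with domain $D(-\Delta_{\mathbf A})\cap V$, is isospectral to $-\Delta_{\mathbf A}$: the two operators have the same spectrum (in particular the spectrum of $-\Delta_{\mathbf A}$ is real). Moreover, for every $\lambda\in\mathbb R$ and every cardinal $k$, the number $\lambda$ is an eigenvalue of $-\Delta_{\mathbf A,V}$ of multiplicity $k$ (the real dimension of the eigenspace) if and only if it is an eigenvalue of $-\Delta_{\mathbf A}$ of multiplicity $2k$ (the complex dimension of the eigenspace), where multiplicity $0$ means that $\lambda$ is not an eigenvalue. -/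

import Mathlib

open MeasureTheory Filter Topology
open scoped ContDiff ComplexConjugate

noncomputable section

namespace AharonovBohm

/-! ## Unbounded operators -/

section Operators

variable {𝕜 E : Type*} [RCLike 𝕜] [NormedAddCommGroup E] [NormedSpace 𝕜 E]

/-- `c` is in the resolvent set of the (partially defined) operator `T` if `T - c` is a bijection
from the domain of `T` onto `E` whose inverse `R` is bounded. -/
def IsResolventPoint (T : E →ₗ.[𝕜] E) (c : 𝕜) : Prop :=
  ∃ R : E →L[𝕜] E, ∀ f u : E, R f = u ↔ ∃ h : u ∈ T.domain, T ⟨u, h⟩ - c • u = f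

/-- The spectrum of a partially defined operator. -/
def spectrumOf (T : E →ₗ.[𝕜] E) : Set 𝕜 := {c | ¬ IsResolventPoint T c}

/-- The eigenspace `{u ∈ D(T) | T u = c u}` (it is `{0}` if `c` is not an eigenvalue). -/
def eigenspaceOf (T : E →ₗ.[𝕜] E) (c : 𝕜) : Submodule 𝕜 E :=
  T.graph.comap (LinearMap.prod LinearMap.id (c • LinearMap.id))

/-- The multiplicity of `c` as an eigenvalue of `T`, the dimension of the eigenspace over the base
field; `c` is an eigenvalue if and only if it is not zero. -/
def multiplicityOf (T : E →ₗ.[𝕜] E) (c : 𝕜) : Cardinal := Module.rank 𝕜 (eigenspaceOf T c)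

end Operators

/-- The restriction of a complex linear operator `T` to a real subspace `V`, as an operator in `V`:
its domain consists of the `v ∈ V ∩ D(T)` with `T v ∈ V`, and it maps `v` to `T v`. -/
def restrictTo {H : Type*} [NormedAddCommGroup H] [NormedSpace ℂ H]
    (T : H →ₗ.[ℂ] H) (V : Submodule ℝ H) : V →ₗ.[ℝ] V :=
  ((T.graph.restrictScalars ℝ).comap (V.subtype.prodMap V.subtype)).toLinearPMap

/-! ## The Friedrichs extension -/

section Friedrichs

variable {H : Type*} [NormedAddCommGroup H] [InnerProductSpace ℂ H]

/-- The real part of the quadratic form `u ↦ ⟪S u, u⟫`. -/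
def qform (S : H →ₗ.[ℂ] H) (x : S.domain) : ℝ := (inner ℂ (S x) (x : H)).re

lemma qform_add_le {S : H →ₗ.[ℂ] H} (hS : ∀ x, 0 ≤ qform S x) (x y : S.domain) :
    qform S (x + y) ≤ 2 * qform S x + 2 * qform S y := by
  have h := hS (x - y)
  simp only [qform, LinearPMap.map_add, LinearPMap.map_sub, Submodule.coe_add, Submodule.coe_sub,
    inner_add_left, inner_add_right, inner_sub_left, inner_sub_right, Complex.add_re,
    Complex.sub_re] at h ⊢
  linarith

lemma qform_smul (S : H →ₗ.[ℂ] H) (c : ℂ) (x : S.domain) :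
    qform S (c • x) = ‖c‖ ^ 2 * qform S x := by
  simp only [qform, LinearPMap.map_smul, Submodule.coe_smul, inner_smul_left, inner_smul_right]
  rw [mul_left_comm, ← mul_assoc, ← Complex.normSq_eq_conj_mul_self,
    Complex.re_ofReal_mul, Complex.normSq_eq_norm_sq]

/-- The domain of the closure of the form `u ↦ ⟪S u, u⟫` of a nonnegative operator `S`: the limits
`u` in `H` of sequences in `D(S)` that are Cauchy for the form. -/
def formDomain (S : H →ₗ.[ℂ] H) (hS : ∀ x, 0 ≤ qform S x) : Submodule ℂ H where
  carrier := {u | ∃ w : ℕ → S.domain, Tendsto (fun n => (w n : H)) atTop (𝓝 u) ∧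
    Tendsto (fun p : ℕ × ℕ => qform S (w p.1 - w p.2)) atTop (𝓝 0)}
  zero_mem' := ⟨fun _ => 0, by simp, by simp [qform]⟩
  add_mem' := by
    rintro u v ⟨w, hw, hw'⟩ ⟨w₂, hw₂, hw₂'⟩
    refine ⟨fun n => w n + w₂ n, by simpa using hw.add hw₂, ?_⟩
    have h := (hw'.const_mul 2).add (hw₂'.const_mul 2)
    simp only [mul_zero, add_zero] at h
    refine squeeze_zero (fun _ => hS _) (fun p => ?_) h
    rw [add_sub_add_comm]
    exact qform_add_le hS _ _
  smul_mem' := by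
    rintro c u ⟨w, hw, hw'⟩
    refine ⟨fun n => c • w n, by simpa using hw.const_smul c, ?_⟩
    simpa [← smul_sub, qform_smul] using hw'.const_mul (‖c‖ ^ 2)

/-- The Friedrichs extension of a (densely defined, symmetric) nonnegative operator `S`: the
restriction of the adjoint `S†` to those elements of its domain that belong to the domain of the
closed form. -/
def friedrichs [CompleteSpace H] (S : H →ₗ.[ℂ] H) (hS : ∀ x, 0 ≤ qform S x) : H →ₗ.[ℂ] H :=
  S.adjoint.domRestrict (formDomain S hS)

end Friedrichs

/-! ## The Aharonov-Bohm operator on test functions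

The plane is identified with `ℂ` through `z = x + i y`. -/

/-- The punctured domain. -/
def punctured (Ω : Set ℂ) : Set ℂ := Ω \ {0}

/-- The Hilbert space of complex square integrable functions on the punctured domain. -/
abbrev L2 (Ω : Set ℂ) := Lp ℂ 2 (volume.restrict (punctured Ω))

/-- First component of the magnetic potential with flux `1/2` at the origin. -/
def A₁ (z : ℂ) : ℝ := (1 / 2) * (-z.im / ‖z‖ ^ 2)

/-- Second component of the magnetic potential with flux `1/2` at the origin. -/
def A₂ (z : ℂ) : ℝ := (1 / 2) * (z.re / ‖z‖ ^ 2)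

/-- The operator `D_e - A`, where `D_e = -i ∂_e` and `∂_e` is the derivative in direction `e`. -/
def momentum (e : ℂ) (A : ℂ → ℝ) (u : ℂ → ℂ) (z : ℂ) : ℂ :=
  -Complex.I * fderiv ℝ u z e - A z * u z

/-- The differential operator `-Δ_A = (D_x - A₁)² + (D_y - A₂)²`. -/
def magneticLaplacian (u : ℂ → ℂ) (z : ℂ) : ℂ :=
  momentum 1 A₁ (momentum 1 A₁ u) z + momentum Complex.I A₂ (momentum Complex.I A₂ u) z

/-- Smooth functions with compact support in the punctured domain. -/
structure IsTestFunction (Ω : Set ℂ) (u : ℂ → ℂ) : Prop where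
  smooth : ContDiff ℝ ∞ u
  compact : HasCompactSupport u
  support_subset : tsupport u ⊆ punctured Ω

lemma IsTestFunction.zero (Ω : Set ℂ) : IsTestFunction Ω 0 :=
  ⟨contDiff_const, HasCompactSupport.zero, by simp [tsupport]⟩

lemma IsTestFunction.add {Ω : Set ℂ} {u v : ℂ → ℂ} (hu : IsTestFunction Ω u)
    (hv : IsTestFunction Ω v) : IsTestFunction Ω (u + v) :=
  ⟨hu.smooth.add hv.smooth, hu.compact.add hv.compact,
    (tsupport_add u v).trans (Set.union_subset hu.support_subset hv.support_subset)⟩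

lemma IsTestFunction.const_smul {Ω : Set ℂ} {u : ℂ → ℂ} (hu : IsTestFunction Ω u) (c : ℂ) :
    IsTestFunction Ω (c • u) :=
  ⟨hu.smooth.const_smul c, hu.compact.smul_left (f := fun _ => c),
    (tsupport_smul_subset_right (fun _ => c) u).trans hu.support_subset⟩

lemma momentum_add (e : ℂ) (A : ℂ → ℝ) {u v : ℂ → ℂ} (hu : Differentiable ℝ u)
    (hv : Differentiable ℝ v) : momentum e A (u + v) = momentum e A u + momentum e A v := by
  ext z
  simp only [momentum, Pi.add_apply]
  rw [fderiv_add (hu z) (hv z)]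
  simp only [add_apply]
  ring

lemma momentum_smul (e : ℂ) (A : ℂ → ℝ) {u : ℂ → ℂ} (hu : Differentiable ℝ u) (c : ℂ) :
    momentum e A (c • u) = c • momentum e A u := by
  ext z
  simp only [momentum, Pi.smul_apply]
  rw [fderiv_const_smul (hu z)]
  simp only [smul_apply, smul_eq_mul]
  ring

lemma contDiffAt_A₁ {z : ℂ} (hz : z ≠ 0) : ContDiffAt ℝ ∞ A₁ z := by
  unfold A₁
  have h1 : ContDiffAt ℝ ∞ (fun w : ℂ => w.im) z := Complex.imCLM.contDiff.contDiffAt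
  have h2 : ContDiffAt ℝ ∞ (fun w : ℂ => ‖w‖ ^ 2) z := (contDiff_norm_sq ℝ).contDiffAt
  exact contDiffAt_const.mul (h1.neg.div h2 (by simpa using hz))

lemma contDiffAt_A₂ {z : ℂ} (hz : z ≠ 0) : ContDiffAt ℝ ∞ A₂ z := by
  unfold A₂
  have h1 : ContDiffAt ℝ ∞ (fun w : ℂ => w.re) z := Complex.reCLM.contDiff.contDiffAt
  have h2 : ContDiffAt ℝ ∞ (fun w : ℂ => ‖w‖ ^ 2) z := (contDiff_norm_sq ℝ).contDiffAt
  exact contDiffAt_const.mul (h1.div h2 (by simpa using hz))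

lemma tsupport_momentum (e : ℂ) (A : ℂ → ℝ) (u : ℂ → ℂ) :
    tsupport (momentum e A u) ⊆ tsupport u := by
  refine closure_minimal (fun z hz => ?_) (isClosed_tsupport u)
  by_contra h
  apply hz
  simp [momentum, fderiv_of_notMem_tsupport (𝕜 := ℝ) h, image_eq_zero_of_notMem_tsupport h]

lemma IsTestFunction.momentum {Ω : Set ℂ} {u : ℂ → ℂ} (hu : IsTestFunction Ω u) (e : ℂ)
    {A : ℂ → ℝ} (hA : ∀ z, z ≠ 0 → ContDiffAt ℝ ∞ A z) : IsTestFunction Ω (momentum e A u) := by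
  refine ⟨?_, hu.compact.of_isClosed_subset (isClosed_tsupport _) (tsupport_momentum e A u),
    (tsupport_momentum e A u).trans hu.support_subset⟩
  have h1 : ContDiff ℝ ∞ (fun z => fderiv ℝ u z e) :=
    (hu.smooth.fderiv_right (m := ∞) (by norm_cast)).clm_apply contDiff_const
  have h2 : ContDiff ℝ ∞ (fun z => (A z : ℂ) * u z) := by
    rw [contDiff_iff_contDiffAt]
    intro z
    by_cases hz : z ∈ tsupport u
    · have hz0 : z ≠ 0 := (hu.support_subset hz).2
      have h3 : ContDiffAt ℝ ∞ (fun z => (A z : ℂ)) z :=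
        Complex.ofRealCLM.contDiff.contDiffAt.comp z (hA z hz0)
      exact h3.mul hu.smooth.contDiffAt
    · have h4 : (fun z => (A z : ℂ) * u z) =ᶠ[𝓝 z] fun _ => 0 := by
        filter_upwards [notMem_tsupport_iff_eventuallyEq.mp hz] with w hw
        simp [hw]
      exact contDiffAt_const.congr_of_eventuallyEq h4
  exact (contDiff_const.mul h1).sub h2

lemma IsTestFunction.integrable_mul {Ω : Set ℂ} {u : ℂ → ℂ} (hu : IsTestFunction Ω u)
    {v : ℂ → ℂ} (hv : Continuous v) : Integrable (fun z => v z * u z) :=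
  (hv.mul hu.smooth.continuous).integrable_of_hasCompactSupport hu.compact.mul_left

lemma integral_momentum {Ω : Set ℂ} {u v : ℂ → ℂ} (hu : IsTestFunction Ω u)
    (hv : IsTestFunction Ω v) (e : ℂ) {A : ℂ → ℝ} (hA : ∀ z, z ≠ 0 → ContDiffAt ℝ ∞ A z) :
    ∫ z, conj (momentum e A u z) * v z = ∫ z, conj (u z) * momentum e A v z := by
  have hcu : IsTestFunction Ω (fun z => conj (u z)) := by
    refine ⟨Complex.conjCLE.contDiff.comp hu.smooth, hu.compact.comp_left (by simp), ?_⟩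
    refine le_trans (closure_mono ?_) hu.support_subset
    intro z hz h
    exact hz (by simp [h])
  have hfd : ∀ z, fderiv ℝ (fun z => conj (u z)) z e = conj (fderiv ℝ u z e) := by
    intro z
    have h := (Complex.conjCLE : ℂ →L[ℝ] ℂ).hasFDerivAt.comp z
      (hu.smooth.differentiable (by simp) z).hasFDerivAt
    rw [show (fun z => conj (u z)) = (Complex.conjCLE : ℂ →L[ℝ] ℂ) ∘ u from rfl, h.fderiv]
    simp
  have cd : ∀ {w : ℂ → ℂ}, IsTestFunction Ω w → Continuous (fun z => fderiv ℝ w z e) := fun hw =>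
    ((hw.smooth.continuous_fderiv (by simp)).clm_apply continuous_const)
  have i1 : Integrable (fun z => fderiv ℝ (fun z => conj (u z)) z e * v z) :=
    hv.integrable_mul (cd hcu)
  have i2 : Integrable (fun z => conj (u z) * fderiv ℝ v z e) := by
    simpa [mul_comm] using hcu.integrable_mul (cd hv)
  have i3 : Integrable (fun z => conj (u z) * v z) := hv.integrable_mul hcu.smooth.continuous
  have key := integral_mul_fderiv_eq_neg_fderiv_mul_of_integrable (μ := volume) i1 i2 i3
    (fun z _ => hcu.smooth.differentiable (by simp) z)
    (fun z _ => hv.smooth.differentiable (by simp) z)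
  have j1 : Integrable (fun z => conj (momentum e A u z) * v z) := by
    refine hv.integrable_mul (Complex.continuous_conj.comp (hu.momentum e hA).smooth.continuous)
  have j2 : Integrable (fun z => conj (u z) * momentum e A v z) :=
    (hv.momentum e hA).integrable_mul hcu.smooth.continuous
  rw [← sub_eq_zero, ← integral_sub j1 j2]
  have e1 : (fun z => conj (momentum e A u z) * v z - conj (u z) * momentum e A v z) =
      fun z => Complex.I * (fderiv ℝ (fun z => conj (u z)) z e * v z +
        conj (u z) * fderiv ℝ v z e) := by
    ext z
    simp only [hfd, momentum, map_sub, map_mul, map_neg, Complex.conj_I, Complex.conj_ofReal]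
    ring
  rw [e1, integral_const_mul, integral_add i1 i2, key]
  simp

lemma IsTestFunction.eq_zero {Ω : Set ℂ} {u : ℂ → ℂ} (hu : IsTestFunction Ω u)
    (h : u =ᵐ[volume.restrict (punctured Ω)] 0) : u = 0 := by
  have hs : Function.support u ⊆ punctured Ω := (subset_tsupport u).trans hu.support_subset
  have hm : MeasurableSet {z | ¬ u z = (0 : ℂ → ℂ) z} :=
    (hu.smooth.continuous.measurable (measurableSet_singleton 0)).compl
  refine (hu.smooth.continuous.ae_eq_iff_eq volume continuous_const).mp ?_
  have h' := h
  rw [Filter.EventuallyEq, ae_iff, Measure.restrict_apply hm] at h'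
  rw [Filter.EventuallyEq, ae_iff]
  have hi : {z | ¬ u z = (0 : ℂ → ℂ) z} ∩ punctured Ω = {z | ¬ u z = (0 : ℂ → ℂ) z} :=
    Set.inter_eq_self_of_subset_left hs
  rwa [hi] at h'

/-- The graph of `-Δ_A` on the smooth functions with compact support in the punctured domain. -/
def minimalGraph (Ω : Set ℂ) : Submodule ℂ (L2 Ω × L2 Ω) where
  carrier := {p | ∃ u : ℂ → ℂ, IsTestFunction Ω u ∧ p.1 =ᵐ[volume.restrict (punctured Ω)] u ∧
    p.2 =ᵐ[volume.restrict (punctured Ω)] magneticLaplacian u}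
  zero_mem' := by
    refine ⟨0, .zero Ω, Lp.coeFn_zero _ _ _, ?_⟩
    have h : magneticLaplacian 0 = 0 := by
      ext z
      have h0 : ∀ (e : ℂ) (A : ℂ → ℝ), momentum e A 0 = 0 := by
        intro e A
        ext z
        simp [momentum]
      simp [magneticLaplacian, h0]
    rw [h]
    exact Lp.coeFn_zero _ _ _
  add_mem' := by
    rintro p q ⟨u, hu, hu1, hu2⟩ ⟨v, hv, hv1, hv2⟩
    refine ⟨u + v, hu.add hv, (Lp.coeFn_add _ _).trans (hu1.add hv1),
      ((Lp.coeFn_add _ _).trans (hu2.add hv2)).trans (Eventually.of_forall fun z => ?_)⟩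
    have du := fun {w : ℂ → ℂ} (hw : IsTestFunction Ω w) => hw.smooth.differentiable (by simp)
    simp only [magneticLaplacian, Pi.add_apply]
    rw [momentum_add _ _ (du hu) (du hv), momentum_add _ _ (du hu) (du hv),
      momentum_add _ _ (du (hu.momentum _ fun _ => contDiffAt_A₁))
        (du (hv.momentum _ fun _ => contDiffAt_A₁)),
      momentum_add _ _ (du (hu.momentum _ fun _ => contDiffAt_A₂))
        (du (hv.momentum _ fun _ => contDiffAt_A₂))]
    simp only [Pi.add_apply]
    ring
  smul_mem' := by
    rintro c p ⟨u, hu, hu1, hu2⟩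
    refine ⟨c • u, hu.const_smul c, (Lp.coeFn_smul _ _).trans (hu1.const_smul c),
      ((Lp.coeFn_smul _ _).trans (hu2.const_smul c)).trans (Eventually.of_forall fun z => ?_)⟩
    have du := fun {w : ℂ → ℂ} (hw : IsTestFunction Ω w) => hw.smooth.differentiable (by simp)
    simp only [magneticLaplacian, Pi.smul_apply]
    rw [momentum_smul _ _ (du hu), momentum_smul _ _ (du hu),
      momentum_smul _ _ (du (hu.momentum _ fun _ => contDiffAt_A₁)),
      momentum_smul _ _ (du (hu.momentum _ fun _ => contDiffAt_A₂))]
    simp only [Pi.smul_apply, smul_eq_mul]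
    ring

/-- The operator `-Δ_A` in `L²` with domain the smooth functions with compact support in the
punctured domain. -/
def minimalOperator (Ω : Set ℂ) : L2 Ω →ₗ.[ℂ] L2 Ω := (minimalGraph Ω).toLinearPMap

lemma minimalOperator_graph (Ω : Set ℂ) : (minimalOperator Ω).graph = minimalGraph Ω := by
  refine Submodule.toLinearPMap_graph_eq _ ?_
  rintro ⟨f, g⟩ ⟨u, hu, h1, h2⟩ hf
  simp only at hf h1 h2
  subst hf
  have hu0 : u = 0 := hu.eq_zero (h1.symm.trans (Lp.coeFn_zero _ _ _))
  have h0 : ∀ (e : ℂ) (A : ℂ → ℝ), momentum e A 0 = 0 := by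
    intro e A
    ext z
    simp [momentum]
  refine Lp.ext (h2.trans ?_)
  have h : magneticLaplacian u = 0 := by
    ext z
    simp [magneticLaplacian, hu0, h0]
  rw [h]
  exact (Lp.coeFn_zero _ _ _).symm

lemma qform_minimalOperator_nonneg (Ω : Set ℂ) (x : (minimalOperator Ω).domain) :
    0 ≤ qform (minimalOperator Ω) x := by
  have hx : ((x : L2 Ω), minimalOperator Ω x) ∈ minimalGraph Ω := by
    rw [← minimalOperator_graph]
    exact LinearPMap.mem_graph _ x
  obtain ⟨u, hu, h1, h2⟩ := hx
  simp only at h1 h2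
  have p1 := hu.momentum 1 fun _ => contDiffAt_A₁
  have p2 := hu.momentum Complex.I fun _ => contDiffAt_A₂
  have q1 := p1.momentum 1 fun _ => contDiffAt_A₁
  have q2 := p2.momentum Complex.I fun _ => contDiffAt_A₂
  have cc : ∀ {w : ℂ → ℂ}, IsTestFunction Ω w → Continuous (fun z => conj (w z)) := fun hw =>
    Complex.continuous_conj.comp hw.smooth.continuous
  have e1 : inner ℂ (minimalOperator Ω x) (x : L2 Ω) =
      ∫ z, conj (magneticLaplacian u z) * u z := by
    rw [L2.inner_def]
    have : ∫ z in punctured Ω, inner ℂ (minimalOperator Ω x z) ((x : L2 Ω) z) =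
        ∫ z in punctured Ω, conj (magneticLaplacian u z) * u z := by
      refine integral_congr_ae ?_
      filter_upwards [h1, h2] with z hz1 hz2
      rw [hz1, hz2, RCLike.inner_apply, mul_comm]
    rw [this]
    refine setIntegral_eq_integral_of_forall_compl_eq_zero fun z hz => ?_
    rw [image_eq_zero_of_notMem_tsupport fun h => hz (hu.support_subset h), mul_zero]
  have e2 : ∫ z, conj (magneticLaplacian u z) * u z =
      (∫ z, conj (momentum 1 A₁ u z) * momentum 1 A₁ u z) +
      ∫ z, conj (momentum Complex.I A₂ u z) * momentum Complex.I A₂ u z := by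
    rw [← integral_momentum p1 hu 1 fun _ => contDiffAt_A₁,
      ← integral_momentum p2 hu Complex.I fun _ => contDiffAt_A₂,
      ← integral_add (hu.integrable_mul (cc q1)) (hu.integrable_mul (cc q2))]
    refine integral_congr_ae (Eventually.of_forall fun z => ?_)
    simp only [magneticLaplacian, map_add]
    ring
  have e3 : ∀ w : ℂ → ℂ, 0 ≤ (∫ z, conj (w z) * w z).re := by
    intro w
    have : ∀ z, conj (w z) * w z = ((Complex.normSq (w z) : ℝ) : ℂ) := fun z =>
      (Complex.normSq_eq_conj_mul_self).symm
    simp_rw [this]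
    rw [integral_complex_ofReal, Complex.ofReal_re]
    exact integral_nonneg fun z => Complex.normSq_nonneg _
  rw [qform, e1, e2, Complex.add_re]
  exact add_nonneg (e3 _) (e3 _)

/-- The Aharonov-Bohm operator `-Δ_A` in `L²` of the punctured domain: the Friedrichs extension of
the differential operator on the smooth functions with compact support. -/
def abOperator (Ω : Set ℂ) : L2 Ω →ₗ.[ℂ] L2 Ω :=
  friedrichs (minimalOperator Ω) (qform_minimalOperator_nonneg Ω)

/-! ## Symmetries -/

/-- The reflection `(x, y) ↦ (-x, y)`. -/
def σ₁ (z : ℂ) : ℂ := ⟨-z.re, z.im⟩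

/-- The reflection `(x, y) ↦ (x, -y)`. -/
def σ₂ (z : ℂ) : ℂ := ⟨z.re, -z.im⟩

lemma measurePreserving_of_image {Ω : Set ℂ} (L : ℂ ≃ₗᵢ[ℝ] ℂ) (h : L '' Ω = Ω) :
    MeasurePreserving L (volume.restrict (punctured Ω)) (volume.restrict (punctured Ω)) := by
  have hp : L ⁻¹' punctured Ω = punctured Ω := by
    ext z
    have : L z ∈ Ω ↔ z ∈ Ω := by
      conv_lhs => rw [← h]
      exact L.injective.mem_set_image
    simp [punctured, this]
  have := L.measurePreserving.restrict_preimage_emb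
    L.toHomeomorph.measurableEmbedding (punctured Ω)
  rwa [hp] at this

lemma measurePreserving_σ₁ {Ω : Set ℂ} (h : σ₁ '' Ω = Ω) :
    MeasurePreserving σ₁ (volume.restrict (punctured Ω)) (volume.restrict (punctured Ω)) := by
  have e : σ₁ = (Complex.conjLIE.trans (LinearIsometryEquiv.neg ℝ) : ℂ ≃ₗᵢ[ℝ] ℂ) := by
    ext z
    apply Complex.ext <;> simp [σ₁]
  rw [e] at h ⊢
  exact measurePreserving_of_image _ h

lemma measurePreserving_σ₂ {Ω : Set ℂ} (h : σ₂ '' Ω = Ω) :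
    MeasurePreserving σ₂ (volume.restrict (punctured Ω)) (volume.restrict (punctured Ω)) := by
  have e : σ₂ = Complex.conjLIE := by
    ext z
    apply Complex.ext <;> simp [σ₂]
  rw [e] at h ⊢
  exact measurePreserving_of_image _ h

/-- The natural action `(Σ₁ u)(x, y) = u(-x, y)`. -/
def Sigma₁ {Ω : Set ℂ} (h₁ : σ₁ '' Ω = Ω) : L2 Ω →ₗ[ℝ] L2 Ω :=
  Lp.compMeasurePreservingₗ ℝ σ₁ (measurePreserving_σ₁ h₁)

/-- The natural action `(Σ₂ u)(x, y) = u(x, -y)`. -/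
def Sigma₂ {Ω : Set ℂ} (h₂ : σ₂ '' Ω = Ω) : L2 Ω →ₗ[ℝ] L2 Ω :=
  Lp.compMeasurePreservingₗ ℝ σ₂ (measurePreserving_σ₂ h₂)

/-- The complex conjugation `Γ u = ū`. -/
def conjugation (Ω : Set ℂ) : L2 Ω →ₗ[ℝ] L2 Ω :=
  ((Complex.conjCLE : ℂ →L[ℝ] ℂ).compLpL 2 (volume.restrict (punctured Ω)) : L2 Ω →L[ℝ] L2 Ω)

/-- The function `exp (i θ)`, where `z = r exp (i θ)`. -/
def phase (z : ℂ) : ℂ := Complex.exp (Complex.arg z * Complex.I)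

lemma memLp_phase_mul {Ω : Set ℂ} (u : L2 Ω) :
    MemLp (fun z => phase z * u z) 2 (volume.restrict (punctured Ω)) := by
  have hm : Measurable phase := by
    unfold phase
    have := Complex.measurable_arg
    fun_prop
  refine (Lp.memLp u).of_le (hm.aestronglyMeasurable.mul (Lp.aestronglyMeasurable u)) ?_
  exact Eventually.of_forall fun z => by simp [phase, Complex.norm_exp_ofReal_mul_I]

/-- Multiplication by `exp (i θ)`. -/
def phaseMul (Ω : Set ℂ) : L2 Ω →ₗ[ℝ] L2 Ω where
  toFun u := (memLp_phase_mul u).toLp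
  map_add' u v := by
    refine Lp.ext ?_
    filter_upwards [(memLp_phase_mul (u + v)).coeFn_toLp, (memLp_phase_mul u).coeFn_toLp,
      (memLp_phase_mul v).coeFn_toLp, Lp.coeFn_add u v,
      Lp.coeFn_add (memLp_phase_mul u).toLp (memLp_phase_mul v).toLp] with z h1 h2 h3 h4 h5
    simp only [h1, h5, Pi.add_apply, h2, h3, h4, mul_add]
  map_smul' c u := by
    refine Lp.ext ?_
    filter_upwards [(memLp_phase_mul (c • u)).coeFn_toLp, (memLp_phase_mul u).coeFn_toLp,
      Lp.coeFn_smul c u, Lp.coeFn_smul c (memLp_phase_mul u).toLp] with z h1 h2 h3 h4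
    simp only [RingHom.id_apply, h1, h4, Pi.smul_apply, h2, h3, mul_smul_comm]

/-- The antilinear operator `K = exp (i θ) Γ`. -/
def K (Ω : Set ℂ) : L2 Ω →ₗ[ℝ] L2 Ω := phaseMul Ω ∘ₗ conjugation Ω

/-- The antilinear operator `Σ₁ᶜ = i Γ Σ₁`. -/
def Sigma₁c {Ω : Set ℂ} (h₁ : σ₁ '' Ω = Ω) : L2 Ω →ₗ[ℝ] L2 Ω :=
  Complex.I • (conjugation Ω ∘ₗ Sigma₁ h₁)

/-- The antilinear operator `Σ₂ᶜ = Γ Σ₂`. -/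
def Sigma₂c {Ω : Set ℂ} (h₂ : σ₂ '' Ω = Ω) : L2 Ω →ₗ[ℝ] L2 Ω :=
  conjugation Ω ∘ₗ Sigma₂ h₂

/-- The real Hilbert space of `K`-real functions, `K u = u`. -/
def L2K (Ω : Set ℂ) : Submodule ℝ (L2 Ω) := LinearMap.eqLocus (K Ω) LinearMap.id

/-- The `K`-real functions with `Σ₁ᶜ u = u`. -/
def L2KSigma₁ {Ω : Set ℂ} (h₁ : σ₁ '' Ω = Ω) : Submodule ℝ (L2 Ω) :=
  L2K Ω ⊓ LinearMap.eqLocus (Sigma₁c h₁) LinearMap.id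

/-- The `K`-real functions with `Σ₁ᶜ u = -u`. -/
def L2KaSigma₁ {Ω : Set ℂ} (h₁ : σ₁ '' Ω = Ω) : Submodule ℝ (L2 Ω) :=
  L2K Ω ⊓ LinearMap.eqLocus (Sigma₁c h₁) (-LinearMap.id)

/-- The `K`-real functions with `Σ₂ᶜ u = u`. -/
def L2KSigma₂ {Ω : Set ℂ} (h₂ : σ₂ '' Ω = Ω) : Submodule ℝ (L2 Ω) :=
  L2K Ω ⊓ LinearMap.eqLocus (Sigma₂c h₂) LinearMap.id

/-- The `K`-real functions with `Σ₂ᶜ u = -u`. -/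
def L2KaSigma₂ {Ω : Set ℂ} (h₂ : σ₂ '' Ω = Ω) : Submodule ℝ (L2 Ω) :=
  L2K Ω ⊓ LinearMap.eqLocus (Sigma₂c h₂) (-LinearMap.id)

end AharonovBohm

end

/-!
The operators `K`, `Σ₁ᶜ` and `Σ₂ᶜ` are conjugations, that is, antiunitary involutions. On test
functions each of them has the form `u ↦ m * conj (u ∘ L)` with an isometry `L` and a unimodular
`m`, and it commutes up to sign with the two momentum operators `D_e - A` (`momentum_twist`): for
the reflections because of the parity of the potential, and for `K` because `exp (i θ)` gauges `-A`
into `A`. So they commute with `-Δ_A` on test functions, and therefore with its Friedrichs extension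
(`IsConjugation.graph_friedrichs`).

Moreover `K` commutes with `Σ₁ᶜ` and `Σ₂ᶜ`, while `Σ₁ᶜ Σ₂ᶜ = -Σ₂ᶜ Σ₁ᶜ`. Hence each of `Σ₁ᶜ`, `Σ₂ᶜ`
exchanges the two eigenspaces of the other one in the real form `{K u = u}` of `L²`. If `V` is one of
these eigenspaces and `J'` is the symmetry that moves it, then `L² = V ⊕ J' V ⊕ i V ⊕ i J' V`, and the
operator acts in the same way on the four summands (`decomposition`). It follows that the
restriction to `V` has the same real resolvent points, and that the real dimension of an eigenspace
of `-Δ_A`, which is twice its complex dimension, is four times that of the eigenspace in `V`.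

The spectrum of `-Δ_A` is real because `(-Δ_A + 1)⁻¹` is a bounded selfadjoint operator, obtained
from the completion of the form domain by Riesz representation (`exists_resolvent_friedrichs`).
-/

noncomputable section

namespace AharonovBohm

/-! ### Resolvents and eigenspaces in terms of graphs -/

section Graph

variable {𝕜 E : Type*} [RCLike 𝕜] [NormedAddCommGroup E] [NormedSpace 𝕜 E]

lemma exists_apply_sub_eq_iff (T : E →ₗ.[𝕜] E) (c : 𝕜) (f u : E) :
    (∃ h : u ∈ T.domain, T ⟨u, h⟩ - c • u = f) ↔ (u, f + c • u) ∈ T.graph := by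
  simp only [LinearPMap.mem_graph_iff, sub_eq_iff_eq_add]
  constructor
  · rintro ⟨h, e⟩
    exact ⟨⟨u, h⟩, rfl, e⟩
  · rintro ⟨⟨y, hy⟩, rfl, e⟩
    exact ⟨hy, e⟩

lemma isResolventPoint_iff_graph {T : E →ₗ.[𝕜] E} {c : 𝕜} : IsResolventPoint T c ↔
    ∃ R : E →L[𝕜] E, ∀ f u : E, R f = u ↔ (u, f + c • u) ∈ T.graph := by
  simp only [IsResolventPoint, exists_apply_sub_eq_iff]

/-- The inverse of `T - c` is automatically linear, so a continuous map suffices for `c` to be a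
resolvent point. -/
lemma isResolventPoint_of_continuous {T : E →ₗ.[𝕜] E} {c : 𝕜} (R : E → E) (hR : Continuous R)
    (h : ∀ f u : E, R f = u ↔ (u, f + c • u) ∈ T.graph) : IsResolventPoint T c := by
  have hmem : ∀ f, (R f, f + c • R f) ∈ T.graph := fun f => (h f _).1 rfl
  refine ⟨⟨⟨⟨R, fun f g => ?_⟩, fun a f => ?_⟩, hR⟩, fun f u => ?_⟩
  · rw [h]
    have := T.graph.add_mem (hmem f) (hmem g)
    rwa [Prod.mk_add_mk, add_add_add_comm, ← smul_add] at this
  · rw [h]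
    have := T.graph.smul_mem a (hmem f)
    rwa [Prod.smul_mk, smul_add, smul_comm a c] at this
  · rw [exists_apply_sub_eq_iff]
    exact h f u

lemma mem_eigenspaceOf {T : E →ₗ.[𝕜] E} {c : 𝕜} {u : E} :
    u ∈ eigenspaceOf T c ↔ (u, c • u) ∈ T.graph := Iff.rfl

end Graph

/-! ### Operators reduced by copies of a real subspace -/

section Restriction

variable {H : Type*} [NormedAddCommGroup H] [NormedSpace ℂ H]

lemma mem_graph_restrictTo {T : H →ₗ.[ℂ] H} {V : Submodule ℝ H} {u f : V} :
    (u, f) ∈ (restrictTo T V).graph ↔ ((u : H), (f : H)) ∈ T.graph := by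
  rw [restrictTo, Submodule.toLinearPMap_graph_eq]
  · rfl
  · rintro ⟨x, y⟩ hx rfl
    exact Subtype.ext (T.graph_fst_eq_zero_snd hx rfl)

/-- A decomposition of `H` into copies of the real subspace `V` that reduces the operator `T`:
every `u` is the sum of the `incl i (comp i u)` with components `comp i u` in `V`, and all the maps
`comp i` and `incl i` leave the graph of `T` invariant. One of the copies, with index `base`, is
`V` itself. -/
structure Decomposition (T : H →ₗ.[ℂ] H) (V : Submodule ℝ H) (ι : Type) [Fintype ι]
    [DecidableEq ι] where
  /-- The component of a vector in the copy of `V` with index `i`. -/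
  comp : ι → H →L[ℝ] H
  /-- The embedding of `V` onto its copy with index `i`. -/
  incl : ι → H →L[ℝ] H
  /-- The index of `V` itself. -/
  base : ι
  incl_base : ∀ u, incl base u = u
  comp_mem : ∀ i u, comp i u ∈ V
  comp_incl : ∀ i j, ∀ v ∈ V, comp i (incl j v) = if i = j then v else 0
  sum_incl_comp : ∀ u, ∑ i, incl i (comp i u) = u
  comp_graph : ∀ i x y, (x, y) ∈ T.graph → (comp i x, comp i y) ∈ T.graph
  incl_graph : ∀ i x y, (x, y) ∈ T.graph → (incl i x, incl i y) ∈ T.graph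

namespace Decomposition

variable {T : H →ₗ.[ℂ] H} {V : Submodule ℝ H} {ι : Type} [Fintype ι] [DecidableEq ι]
  (d : Decomposition T V ι)

include d

lemma comp_base {v : H} (hv : v ∈ V) : d.comp d.base v = v := by
  have := d.comp_incl d.base d.base v hv
  rwa [d.incl_base, if_pos rfl] at this

lemma mem_of_graph {u f : H} (hu : u ∈ V) (h : (u, f) ∈ T.graph) : f ∈ V := by
  have h1 := d.comp_graph d.base u f h
  rw [d.comp_base hu] at h1
  rw [T.mem_graph_snd_inj h h1 rfl]
  exact d.comp_mem _ _

lemma apply_mem (u : T.domain) (hu : (u : H) ∈ V) : T u ∈ V :=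
  d.mem_of_graph hu (T.mem_graph u)

/-- The resolvent of `T` at a real point maps `V` to itself, as it commutes with the projection onto
`V`. -/
lemma isResolventPoint_restrictTo {c : ℝ} (h : IsResolventPoint T (c : ℂ)) :
    IsResolventPoint (restrictTo T V) c := by
  obtain ⟨R, hR⟩ := isResolventPoint_iff_graph.1 h
  simp only [Complex.coe_smul] at hR
  have hV : ∀ f : V, R f ∈ V := by
    intro f
    have h1 := d.comp_graph d.base _ _ ((hR f _).1 rfl)
    rw [map_add, map_smul, d.comp_base f.2] at h1
    rw [(hR f _).2 h1]
    exact d.comp_mem _ _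
  refine isResolventPoint_of_continuous (fun f => ⟨R f, hV f⟩)
    ((R.continuous.comp continuous_subtype_val).subtype_mk _) fun f u => ?_
  rw [mem_graph_restrictTo, Subtype.ext_iff]
  exact hR f u

/-- The resolvent of `T` is obtained by letting the resolvent of the restriction act on each copy of
`V`. -/
lemma isResolventPoint_of_restrictTo {c : ℝ} (h : IsResolventPoint (restrictTo T V) c) :
    IsResolventPoint T (c : ℂ) := by
  obtain ⟨R, hR⟩ := isResolventPoint_iff_graph.1 h
  simp only [mem_graph_restrictTo, Submodule.coe_add,
    Submodule.coe_smul] at hR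
  let Q : H → H := fun f => ∑ i, d.incl i (R ⟨d.comp i f, d.comp_mem i f⟩)
  have hQ : Continuous Q := continuous_finsetSum _ fun i _ => (d.incl i).continuous.comp
    (continuous_subtype_val.comp (R.continuous.comp ((d.comp i).continuous.subtype_mk _)))
  have hmem : ∀ f, (Q f, f + c • Q f) ∈ T.graph := by
    intro f
    have h1 : ∀ i, (d.incl i (R ⟨d.comp i f, d.comp_mem i f⟩), d.incl i (d.comp i f) +
        c • d.incl i (R ⟨d.comp i f, d.comp_mem i f⟩)) ∈ T.graph := by
      intro i
      have := d.incl_graph i _ _ ((hR ⟨d.comp i f, d.comp_mem i f⟩ _).1 rfl)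
      rwa [map_add, map_smul] at this
    have h2 := T.graph.sum_mem fun i (_ : i ∈ Finset.univ) => h1 i
    rw [← prod_mk_sum, Finset.sum_add_distrib, d.sum_incl_comp, ← Finset.smul_sum] at h2
    exact h2
  have hinj : ∀ u : H, (u, c • u) ∈ T.graph → u = 0 := by
    intro u hu
    have h1 : ∀ i, d.comp i u = 0 := by
      intro i
      have h2 := d.comp_graph i _ _ hu
      rw [map_smul] at h2
      have h3 := (hR 0 ⟨d.comp i u, d.comp_mem i u⟩).2 (by simpa using h2)
      rw [map_zero] at h3
      exact (Subtype.ext_iff.1 h3).symm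
    rw [← d.sum_incl_comp u]
    simp [h1]
  refine isResolventPoint_of_continuous Q hQ fun f u => ?_
  rw [Complex.coe_smul]
  refine ⟨fun h => h ▸ hmem f, fun h => ?_⟩
  refine sub_eq_zero.1 (hinj _ ?_)
  have := T.graph.sub_mem (hmem f) h
  rwa [Prod.mk_sub_mk, add_sub_add_left_eq_sub, ← smul_sub] at this

lemma isResolventPoint_iff (c : ℝ) :
    IsResolventPoint T (c : ℂ) ↔ IsResolventPoint (restrictTo T V) c :=
  ⟨d.isResolventPoint_restrictTo, d.isResolventPoint_of_restrictTo⟩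

/-- The eigenspace of `T` is, over `ℝ`, a direct sum of copies of the eigenspace of the
restriction. -/
def eigenspaceEquiv (c : ℝ) :
    eigenspaceOf T (c : ℂ) ≃ₗ[ℝ] (ι → eigenspaceOf (restrictTo T V) c) where
  toFun u i := ⟨⟨d.comp i u, d.comp_mem i u⟩, by
    have h := d.comp_graph i _ _ (mem_eigenspaceOf.1 u.2)
    rw [Complex.coe_smul, map_smul] at h
    exact mem_eigenspaceOf.2 (mem_graph_restrictTo.2 h)⟩
  map_add' u v := by
    ext i
    simp
  map_smul' a u := by
    ext i
    simp
  invFun w := ⟨∑ i, d.incl i (w i : V), by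
    have h1 : ∀ i, (d.incl i (w i : V), c • d.incl i (w i : V)) ∈ T.graph := by
      intro i
      have := d.incl_graph i _ _ (mem_graph_restrictTo.1 (mem_eigenspaceOf.1 (w i).2))
      rwa [Submodule.coe_smul, map_smul] at this
    have h2 := T.graph.sum_mem fun i (_ : i ∈ Finset.univ) => h1 i
    rw [← prod_mk_sum, ← Finset.smul_sum] at h2
    rw [mem_eigenspaceOf, Complex.coe_smul]
    exact h2⟩
  left_inv u := Subtype.ext (d.sum_incl_comp u)
  right_inv w := by
    ext i
    simp [map_sum, d.comp_incl _ _ _ (w _ : V).2]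

lemma two_mul_multiplicityOf (c : ℝ) : 2 * multiplicityOf T (c : ℂ) =
    Fintype.card ι * multiplicityOf (restrictTo T V) c := by
  have h1 := (d.eigenspaceEquiv c).rank_eq
  rw [rank_fun_eq_lift_mul, Cardinal.lift_uzero] at h1
  have h2 := rank_real_of_complex (eigenspaceOf T (c : ℂ))
  rw [multiplicityOf, multiplicityOf, ← h1, h2]

end Decomposition

end Restriction

lemma cardinal_two_mul_cancel {a b : Cardinal} (h : 2 * a = 2 * b) : a = b := by
  have hle : ∀ c : Cardinal, c ≤ 2 * c := fun c => by
    simpa using mul_le_mul_left (one_le_two : (1 : Cardinal) ≤ 2) c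
  have hinf : ∀ c : Cardinal, Cardinal.aleph0 ≤ c → 2 * c = c := fun c hc =>
    Cardinal.mul_eq_right hc ((Cardinal.natCast_lt_aleph0 (n := 2)).le.trans hc) two_ne_zero
  have hfin : ∀ c : Cardinal, c < Cardinal.aleph0 → 2 * c < Cardinal.aleph0 := fun c hc =>
    Cardinal.mul_lt_aleph0 (Cardinal.natCast_lt_aleph0 (n := 2)) hc
  rcases lt_or_ge a Cardinal.aleph0 with ha | ha
  · have hb : b < Cardinal.aleph0 := (hle b).trans_lt (h ▸ hfin a ha)
    lift a to ℕ using ha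
    lift b to ℕ using hb
    norm_cast at h ⊢
    omega
  · have hb : Cardinal.aleph0 ≤ b := by
      by_contra hb
      exact absurd (h ▸ hfin b (not_le.1 hb)) (not_lt.2 (ha.trans (hle a)))
    rwa [hinf a ha, hinf b hb] at h

/-! ### Conjugations -/

section Conjugations

variable {H : Type*} [NormedAddCommGroup H] [InnerProductSpace ℂ H]

/-- A conjugation: an antiunitary involution. -/
structure IsConjugation (W : H →ₗ[ℝ] H) : Prop where
  map_smul_conj : ∀ (c : ℂ) (x : H), W (c • x) = conj c • W x
  apply_apply : ∀ x, W (W x) = x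
  inner_map : ∀ x y, inner ℂ (W x) (W y) = inner ℂ y x

namespace IsConjugation

variable {W : H →ₗ[ℝ] H} (hW : IsConjugation W)

include hW

lemma norm_map (x : H) : ‖W x‖ = ‖x‖ := by
  rw [← sq_eq_sq₀ (norm_nonneg _) (norm_nonneg _), ← inner_self_eq_norm_sq (𝕜 := ℂ),
    ← inner_self_eq_norm_sq (𝕜 := ℂ), hW.inner_map]

/-- A conjugation as a continuous real linear map. -/
def toCLM : H →L[ℝ] H := W.mkContinuous 1 fun x => by rw [hW.norm_map, one_mul]

@[simp]
lemma toCLM_apply (x : H) : hW.toCLM x = W x := rfl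

lemma map_I (x : H) : W (Complex.I • x) = -(Complex.I • W x) := by
  rw [hW.map_smul_conj, Complex.conj_I, neg_smul]

lemma neg : IsConjugation (-W) where
  map_smul_conj c x := by simp [hW.map_smul_conj]
  apply_apply x := by simp [hW.apply_apply]
  inner_map x y := by simp [hW.inner_map]

end IsConjugation

/-- Three conjugations `K`, `J` and `J'` that commute with `T`, where `K` commutes with `J` and `J'`
while `J` and `J'` anticommute, decompose `H` into four copies of the space of common fixed points
of `K` and `J`. Indeed, `J'` exchanges the `J`-symmetric and the `J`-antisymmetric elements of the
real form `{K u = u}`, and `H` is the direct sum of this real form and its multiple by `i`. -/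
def decomposition {T : H →ₗ.[ℂ] H} {K J J' : H →ₗ[ℝ] H} (hK : IsConjugation K)
    (hJ : IsConjugation J) (hJ' : IsConjugation J') (hKJ : ∀ x, K (J x) = J (K x))
    (hKJ' : ∀ x, K (J' x) = J' (K x)) (hJJ' : ∀ x, J (J' x) = -J' (J x))
    (hKT : ∀ x y, (x, y) ∈ T.graph → (K x, K y) ∈ T.graph)
    (hJT : ∀ x y, (x, y) ∈ T.graph → (J x, J y) ∈ T.graph)
    (hJT' : ∀ x y, (x, y) ∈ T.graph → (J' x, J' y) ∈ T.graph)
    {V : Submodule ℝ H} (hV : ∀ x, x ∈ V ↔ K x = x ∧ J x = x) : Decomposition T V (Fin 4) := by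
  let i : H →L[ℝ] H := Complex.I • ContinuousLinearMap.id ℝ H
  -- the orthogonal projection onto the common fixed points of `K` and `J`
  let P : H →L[ℝ] H := (4⁻¹ : ℝ) • (ContinuousLinearMap.id ℝ H + hK.toCLM + hJ.toCLM +
    hK.toCLM ∘L hJ.toCLM)
  have hi : ∀ x, i x = Complex.I • x := fun x => rfl
  have hP : ∀ x, P x = (4⁻¹ : ℝ) • (x + K x + J x + K (J x)) := fun x => rfl
  have hiT : ∀ x y, (x, y) ∈ T.graph → (i x, i y) ∈ T.graph := fun x y h =>
    T.graph.smul_mem Complex.I h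
  have hPT : ∀ x y, (x, y) ∈ T.graph → (P x, P y) ∈ T.graph := by
    intro x y h
    have h1 := (T.graph.restrictScalars ℝ).smul_mem (4⁻¹ : ℝ) (T.graph.add_mem (T.graph.add_mem
      (T.graph.add_mem h (hKT _ _ h)) (hJT _ _ h)) (hKT _ _ (hJT _ _ h)))
    exact h1
  have hPV : ∀ x, P x ∈ V := by
    intro x
    rw [hV, hP]
    simp only [map_smul, map_add, hK.apply_apply, hJ.apply_apply, ← hKJ]
    constructor <;> abel_nf
  have hI : ∀ x : H, Complex.I • Complex.I • x = -x := fun x => by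
    rw [smul_smul, Complex.I_mul_I, neg_one_smul]
  refine
    { comp := ![P, P ∘L hJ'.toCLM, -(P ∘L i), -(P ∘L hJ'.toCLM ∘L i)]
      incl := ![ContinuousLinearMap.id ℝ H, hJ'.toCLM, i, i ∘L hJ'.toCLM]
      base := 0
      incl_base := fun u => rfl
      comp_mem := fun j u => ?_
      comp_incl := fun j k v hv => ?_
      sum_incl_comp := fun u => ?_
      comp_graph := fun j x y h => ?_
      incl_graph := fun j x y h => ?_ }
  · fin_cases j
    exacts [hPV _, hPV _, V.neg_mem (hPV _), V.neg_mem (hPV _)]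
  · obtain ⟨hv1, hv2⟩ := (hV v).1 hv
    have e : (4⁻¹ : ℝ) • (v + v + v + v) = v := by
      module
    fin_cases j <;> fin_cases k <;>
      simp [hi, hP, hK.map_I, hJ.map_I, hJ'.map_I, hJ'.apply_apply, hKJ', hJJ', hv1, hv2, hI] <;>
      module
  · simp [Fin.sum_univ_four, hi, hP, hK.map_I, hJ.map_I, hJ'.map_I, hJ'.apply_apply, hKJ', hJJ',
      hI, smul_comm Complex.I (4⁻¹ : ℝ)]
    module
  · fin_cases j
    exacts [hPT _ _ h, hPT _ _ (hJT' _ _ h), T.graph.neg_mem (hPT _ _ (hiT _ _ h)),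
      T.graph.neg_mem (hPT _ _ (hJT' _ _ (hiT _ _ h)))]
  · fin_cases j
    exacts [h, hJT' _ _ h, hiT _ _ h, hiT _ _ (hJT' _ _ h)]

end Conjugations

/-! ### The resolvent of the Friedrichs extension -/

section FriedrichsResolvent

universe u

variable {H : Type u} [NormedAddCommGroup H] [InnerProductSpace ℂ H]

/-- The domain of `S` with the energy inner product `⟪S x, y⟫ + ⟪x, y⟫`. It is a separate type since
the domain itself carries the norm of `H`. -/
def FormSpace (S : H →ₗ.[ℂ] H) (_ : S.IsFormalAdjoint S) (_ : ∀ x, 0 ≤ qform S x) : Type u :=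
  S.domain

namespace FormSpace

variable {S : H →ₗ.[ℂ] H} (hsym : S.IsFormalAdjoint S) (hS : ∀ x, 0 ≤ qform S x)

instance : AddCommGroup (FormSpace S hsym hS) := inferInstanceAs (AddCommGroup S.domain)

instance : Module ℂ (FormSpace S hsym hS) := inferInstanceAs (Module ℂ S.domain)

/-- The identity map from the domain of `S` to the form space. -/
def of : S.domain ≃ₗ[ℂ] FormSpace S hsym hS := LinearEquiv.refl ℂ S.domain

instance core : InnerProductSpace.Core ℂ (FormSpace S hsym hS) where
  inner x y := inner ℂ (S ((of hsym hS).symm x)) ((of hsym hS).symm y : H) +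
    inner ℂ ((of hsym hS).symm x : H) ((of hsym hS).symm y : H)
  conj_inner_symm x y := by
    rw [map_add, inner_conj_symm, inner_conj_symm, hsym]
  re_inner_nonneg x := by
    rw [map_add]
    exact add_nonneg (hS _) inner_self_nonneg
  add_left x y z := by
    simp only [map_add, LinearPMap.map_add, Submodule.coe_add, inner_add_left]
    ring
  smul_left x y r := by
    simp only [map_smul, LinearPMap.map_smul, Submodule.coe_smul, inner_smul_left]
    ring
  definite x hx := by
    have h1 := congrArg Complex.re hx
    rw [Complex.add_re, Complex.zero_re] at h1
    have h2 : (0 : ℝ) ≤ _ := hS ((of hsym hS).symm x)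
    have h3 : (0 : ℝ) ≤ Complex.re _ := inner_self_nonneg (𝕜 := ℂ) (x := ((of hsym hS).symm x : H))
    have h4 : Complex.re (inner ℂ ((of hsym hS).symm x : H) ((of hsym hS).symm x : H)) = 0 := by
      simp only [qform] at h2
      linarith
    have h5 : ((of hsym hS).symm x : H) = 0 := by
      rw [← norm_eq_zero, ← sq_eq_zero_iff, ← inner_self_eq_norm_sq (𝕜 := ℂ)]
      exact h4
    exact (LinearEquiv.map_eq_zero_iff _).1 (Subtype.ext h5)

instance : NormedAddCommGroup (FormSpace S hsym hS) :=
  InnerProductSpace.Core.toNormedAddCommGroup (𝕜 := ℂ)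

instance : InnerProductSpace ℂ (FormSpace S hsym hS) := InnerProductSpace.ofCore _

lemma inner_of (x y : S.domain) : inner ℂ (of hsym hS x) (of hsym hS y) =
    inner ℂ (S x) (y : H) + inner ℂ (x : H) (y : H) := rfl

end FormSpace

/-- The Hilbert space completion of the domain of a symmetric nonnegative operator with respect to
the energy inner product. -/
lemma exists_form_completion {S : H →ₗ.[ℂ] H} (hsym : S.IsFormalAdjoint S)
    (hS : ∀ x, 0 ≤ qform S x) :
    ∃ (Q : Type u) (_ : NormedAddCommGroup Q) (_ : InnerProductSpace ℂ Q) (_ : CompleteSpace Q)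
      (ι : S.domain →ₗ[ℂ] Q), DenseRange ι ∧
      ∀ x y, inner ℂ (ι x) (ι y) = inner ℂ (S x) (y : H) + inner ℂ (x : H) (y : H) := by
  refine ⟨UniformSpace.Completion (FormSpace S hsym hS), inferInstance, inferInstance,
    inferInstance, (UniformSpace.Completion.toComplL (𝕜 := ℂ)).toLinearMap ∘ₗ
      (FormSpace.of hsym hS).toLinearMap, ?_, fun x y => ?_⟩
  · exact UniformSpace.Completion.denseRange_coe.comp (FormSpace.of hsym hS).surjective.denseRange
      (UniformSpace.Completion.continuous_coe _)
  · exact (UniformSpace.Completion.inner_coe _ _).trans (FormSpace.inner_of hsym hS x y)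

variable [CompleteSpace H] {S : H →ₗ.[ℂ] H} (hS : ∀ x, 0 ≤ qform S x)

lemma mem_graph_adjoint (hd : Dense (S.domain : Set H)) {u f : H} :
    (u, f) ∈ S.adjoint.graph ↔ ∀ v : S.domain, inner ℂ f (v : H) = inner ℂ u (S v) := by
  rw [LinearPMap.mem_graph_iff]
  constructor
  · rintro ⟨y, rfl, rfl⟩ v
    exact LinearPMap.adjoint_isFormalAdjoint hd y v
  · intro h
    have hu := LinearPMap.mem_adjoint_domain_of_exists u ⟨f, h⟩
    exact ⟨⟨u, hu⟩, rfl, LinearPMap.adjoint_apply_eq hd ⟨u, hu⟩ h⟩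

lemma mem_graph_friedrichs (hd : Dense (S.domain : Set H)) {u f : H} :
    (u, f) ∈ (friedrichs S hS).graph ↔ u ∈ formDomain S hS ∧
      ∀ v : S.domain, inner ℂ f (v : H) = inner ℂ u (S v) := by
  rw [← mem_graph_adjoint hd, LinearPMap.mem_graph_iff, LinearPMap.mem_graph_iff]
  constructor
  · rintro ⟨⟨y, hy⟩, rfl, rfl⟩
    exact ⟨hy.1, ⟨y, hy.2⟩, rfl, (LinearPMap.domRestrict_apply rfl).symm⟩
  · rintro ⟨hu, y, rfl, rfl⟩
    exact ⟨⟨y, hu, y.2⟩, rfl, LinearPMap.domRestrict_apply rfl⟩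

/-- The inverse of `T + 1`, where `T` is the Friedrichs extension of `S`, is a selfadjoint bounded
operator: it is `J J†`, where `J` is the map from the completed form domain to `H`. -/
lemma exists_resolvent_friedrichs (hd : Dense (S.domain : Set H)) (hsym : S.IsFormalAdjoint S) :
    ∃ R : H →L[ℂ] H, IsSelfAdjoint R ∧
      ∀ f u, R f = u ↔ (u, f - u) ∈ (friedrichs S hS).graph := by
  obtain ⟨Q, _, _, _, ι, hι, hinner⟩ := exists_form_completion hsym hS
  have hnorm : ∀ x, ‖ι x‖ ^ 2 = qform S x + ‖(x : H)‖ ^ 2 := by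
    intro x
    rw [← inner_self_eq_norm_sq (𝕜 := ℂ), hinner, map_add, inner_self_eq_norm_sq]
    rfl
  have hle : ∀ x : S.domain, ‖S.domain.subtype x‖ ≤ 1 * ‖ι x‖ := by
    intro x
    rw [one_mul]
    refine (sq_le_sq₀ (norm_nonneg _) (norm_nonneg _)).1 ?_
    rw [hnorm]
    exact le_add_of_nonneg_left (hS x)
  let J : Q →L[ℂ] H := S.domain.subtype.extendOfNorm ι
  have hJι : ∀ x : S.domain, J (ι x) = x := fun x =>
    LinearMap.extendOfNorm_eq hι ⟨1, hle⟩ x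
  have hJinner : ∀ (q : Q) (v : S.domain),
      inner ℂ q (ι v) = inner ℂ (J q) (S v) + inner ℂ (J q) (v : H) := by
    intro q v
    refine hι.induction_on (p := fun q => inner ℂ q (ι v) = inner ℂ (J q) (S v) +
      inner ℂ (J q) (v : H)) q (isClosed_eq (by fun_prop) (by fun_prop)) fun x => ?_
    rw [hinner, hJι, hsym]
  have hadj : ∀ (f : H) (v : S.domain), inner ℂ (J.adjoint f) (ι v) = inner ℂ f (v : H) := by
    intro f v
    rw [ContinuousLinearMap.adjoint_inner_left, hJι]
  have hJmem : ∀ q : Q, J q ∈ formDomain S hS := by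
    intro q
    obtain ⟨w, hw, hlim⟩ := mem_closure_iff_seq_limit.1 (hι q)
    choose x hx using hw
    obtain rfl : (fun n => ι (x n)) = w := funext hx
    refine ⟨x, ?_, ?_⟩
    · have := (J.continuous.tendsto q).comp hlim
      simpa only [Function.comp_def, hJι] using this
    · have h1 : Tendsto (fun p : ℕ × ℕ => ‖ι (x p.1) - ι (x p.2)‖ ^ 2) atTop (𝓝 0) := by
        rw [← prod_atTop_atTop_eq]
        have := (((hlim.comp tendsto_fst).sub (hlim.comp tendsto_snd)).norm.pow 2 :
          Tendsto _ (atTop ×ˢ atTop) _)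
        simpa using this
      refine squeeze_zero (fun _ => hS _) (fun p => ?_) h1
      rw [← map_sub, hnorm]
      exact le_add_of_nonneg_right (sq_nonneg _)
  have hJsurj : ∀ u ∈ formDomain S hS, ∃ q, J q = u := by
    rintro u ⟨x, hx, hq⟩
    have h1 : Tendsto (fun p : ℕ × ℕ => ‖ι (x p.1) - ι (x p.2)‖ ^ 2) atTop (𝓝 0) := by
      have h2 : Tendsto (fun p : ℕ × ℕ => ‖(x p.1 : H) - x p.2‖ ^ 2) atTop (𝓝 0) := by
        rw [← prod_atTop_atTop_eq]
        have := (((hx.comp tendsto_fst).sub (hx.comp tendsto_snd)).norm.pow 2 :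
          Tendsto _ (atTop ×ˢ atTop) _)
        simpa using this
      have h3 := hq.add h2
      rw [add_zero] at h3
      refine h3.congr fun p => ?_
      rw [← map_sub, hnorm, Submodule.coe_sub]
    have h4 : CauchySeq fun n => ι (x n) := by
      rw [cauchySeq_iff_tendsto_dist_atTop_0]
      have := h1.sqrt
      simpa [dist_eq_norm, Real.sqrt_sq] using this
    obtain ⟨q, hlim⟩ := cauchySeq_tendsto_of_complete h4
    refine ⟨q, tendsto_nhds_unique ?_ hx⟩
    have := (J.continuous.tendsto q).comp hlim
    simpa only [Function.comp_def, hJι] using this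
  refine ⟨J ∘L J.adjoint, ?_, fun f u => ?_⟩
  · rw [ContinuousLinearMap.isSelfAdjoint_iff', ContinuousLinearMap.adjoint_comp,
      ContinuousLinearMap.adjoint_adjoint]
  · rw [mem_graph_friedrichs hS hd]
    constructor
    · rintro rfl
      refine ⟨hJmem _, fun v => ?_⟩
      have := hJinner (J.adjoint f) v
      rw [hadj] at this
      rw [inner_sub_left, this]
      exact add_sub_cancel_right _ _
    · rintro ⟨hu, hv⟩
      obtain ⟨q, rfl⟩ := hJsurj u hu
      have h1 : q = J.adjoint f := by
        refine hι.eq_of_inner_left ℂ fun v => ?_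
        rw [hadj, hJinner, ← hv, inner_sub_left, sub_add_cancel]
      rw [h1]
      rfl

/-- The spectrum of the Friedrichs extension is real. -/
lemma isResolventPoint_friedrichs (hd : Dense (S.domain : Set H)) (hsym : S.IsFormalAdjoint S)
    {c : ℂ} (hc : c.im ≠ 0) : IsResolventPoint (friedrichs S hS) c := by
  obtain ⟨R, hR, hRiff⟩ := exists_resolvent_friedrichs hS hd hsym
  have hc0 : c + 1 ≠ 0 := fun h => hc (by simpa using congrArg Complex.im h)
  -- `T - c = (T + 1) (1 - (c + 1) R)`, and `(c + 1)⁻¹` is not in the spectrum of `R`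
  have hns : (c + 1)⁻¹ ∉ spectrum ℂ R := by
    intro h
    have h1 := hR.im_eq_zero_of_mem_spectrum h
    rw [Complex.inv_im, div_eq_zero_iff, Complex.normSq_eq_zero] at h1
    rcases h1 with h1 | h1
    · exact hc (by simpa using h1)
    · exact hc0 h1
  obtain ⟨B, hB⟩ := spectrum.notMem_iff.1 hns
  refine isResolventPoint_iff_graph.2 ⟨(c + 1)⁻¹ • ((B⁻¹ : (H →L[ℂ] H)ˣ) : H →L[ℂ] H) ∘L R,
    fun f u => ?_⟩
  have h1 : ∀ x y : H, ((B⁻¹ : (H →L[ℂ] H)ˣ) : H →L[ℂ] H) x = y ↔ x = (B : H →L[ℂ] H) y := by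
    intro x y
    constructor
    · rintro rfl
      exact (congrArg (fun A : H →L[ℂ] H => A x) B.mul_inv).symm
    · rintro rfl
      exact congrArg (fun A : H →L[ℂ] H => A y) B.inv_mul
  have h2 : (u, f + c • u) ∈ (friedrichs S hS).graph ↔ R (f + (c + 1) • u) = u := by
    rw [hRiff, add_smul, one_smul, ← add_assoc, add_sub_cancel_right]
  rw [h2, smul_apply, ContinuousLinearMap.comp_apply, ← map_smul, h1, hB]
  simp only [sub_apply, ContinuousLinearMap.algebraMap_apply, map_add, map_smul]
  rw [eq_sub_iff_add_eq, ← smul_right_inj hc0 (M := H), smul_add, smul_inv_smul₀ hc0,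
    smul_inv_smul₀ hc0]

/-- A conjugation that commutes with `S` commutes with its Friedrichs extension. -/
lemma IsConjugation.graph_friedrichs {W : H →ₗ[ℝ] H} (hW : IsConjugation W)
    (hd : Dense (S.domain : Set H)) (hWS : ∀ x y, (x, y) ∈ S.graph → (W x, W y) ∈ S.graph)
    (x y : H) (h : (x, y) ∈ (friedrichs S hS).graph) : (W x, W y) ∈ (friedrichs S hS).graph := by
  have hWd : ∀ v : S.domain, ∃ hv : W v ∈ S.domain, S ⟨W v, hv⟩ = W (S v) := by
    intro v
    obtain ⟨⟨z, hz⟩, rfl, h2⟩ := (LinearPMap.mem_graph_iff _).1 (hWS _ _ (S.mem_graph v))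
    exact ⟨hz, h2⟩
  choose hWd hWapp using hWd
  rw [mem_graph_friedrichs hS hd] at h ⊢
  obtain ⟨⟨w, hw, hq⟩, h2⟩ := h
  refine ⟨⟨fun n => ⟨W (w n), hWd _⟩, ?_, ?_⟩, fun v => ?_⟩
  · exact (hW.toCLM.continuous.tendsto x).comp hw
  · refine hq.congr fun p => ?_
    have h3 : (⟨W (w p.1), hWd _⟩ - ⟨W (w p.2), hWd _⟩ : S.domain) =
        ⟨W (w p.1 - w p.2 : S.domain), hWd _⟩ := Subtype.ext (map_sub W _ _).symm
    rw [h3, qform, qform, hWapp, hW.inner_map, ← inner_conj_symm, Complex.conj_re]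
  · have h3 := h2 ⟨W v, hWd v⟩
    rw [hWapp] at h3
    have h4 := congrArg conj h3
    rw [inner_conj_symm, inner_conj_symm, ← hW.inner_map, ← hW.inner_map x, hW.apply_apply,
      hW.apply_apply] at h4
    exact h4

end FriedrichsResolvent

/-! ### The minimal operator is densely defined and symmetric -/

section Minimal

variable {Ω : Set ℂ}

lemma isOpen_punctured (hΩ : IsOpen Ω) : IsOpen (punctured Ω) := hΩ.sdiff isClosed_singleton

lemma IsTestFunction.memLp {u : ℂ → ℂ} (hu : IsTestFunction Ω u) :
    MemLp u 2 (volume.restrict (punctured Ω)) :=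
  (hu.smooth.continuous.memLp_of_hasCompactSupport hu.compact).restrict _

lemma IsTestFunction.magneticLaplacian {u : ℂ → ℂ} (hu : IsTestFunction Ω u) :
    IsTestFunction Ω (magneticLaplacian u) :=
  ((hu.momentum 1 fun _ => contDiffAt_A₁).momentum 1 fun _ => contDiffAt_A₁).add
    ((hu.momentum Complex.I fun _ => contDiffAt_A₂).momentum Complex.I fun _ => contDiffAt_A₂)

lemma IsTestFunction.toLp_mem_domain {u : ℂ → ℂ} (hu : IsTestFunction Ω u) :
    hu.memLp.toLp u ∈ (minimalOperator Ω).domain := by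
  have h : (hu.memLp.toLp u, hu.magneticLaplacian.memLp.toLp _) ∈ (minimalOperator Ω).graph := by
    rw [minimalOperator_graph]
    exact ⟨u, hu, hu.memLp.coeFn_toLp, hu.magneticLaplacian.memLp.coeFn_toLp⟩
  exact LinearPMap.mem_domain_of_mem_graph h

lemma inner_eq_integral {f g : L2 Ω} {u v : ℂ → ℂ} (hf : f =ᵐ[volume.restrict (punctured Ω)] u)
    (hg : g =ᵐ[volume.restrict (punctured Ω)] v) (h : ∀ z ∉ punctured Ω, conj (u z) * v z = 0) :
    inner ℂ f g = ∫ z, conj (u z) * v z := by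
  have e : ∫ z in punctured Ω, inner ℂ (f z) (g z) = ∫ z in punctured Ω, conj (u z) * v z := by
    refine integral_congr_ae ?_
    filter_upwards [hf, hg] with z h1 h2
    rw [h1, h2, RCLike.inner_apply, mul_comm]
  rw [L2.inner_def, e]
  exact setIntegral_eq_integral_of_forall_compl_eq_zero h

lemma dense_domain_minimalOperator (hΩ : IsOpen Ω) :
    Dense ((minimalOperator Ω).domain : Set (L2 Ω)) := by
  rw [Submodule.dense_iff_topologicalClosure_eq_top, Submodule.topologicalClosure_eq_top_iff,
    Submodule.eq_bot_iff]
  intro f hf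
  have hloc : LocallyIntegrableOn f (punctured Ω) volume :=
    locallyIntegrableOn_of_locallyIntegrable_restrict
      ((Lp.memLp f).locallyIntegrable (by norm_num))
  have h0 := (isOpen_punctured hΩ).ae_eq_zero_of_integral_contDiff_smul_eq_zero hloc
    fun g hg hgc hgs => ?_
  · refine Lp.ext ?_
    filter_upwards [(ae_restrict_iff' (isOpen_punctured hΩ).measurableSet).2 h0,
      Lp.coeFn_zero ℂ 2 (volume.restrict (punctured Ω))] with z h1 h2
    rw [h1, h2, Pi.zero_apply]
  · have hu : IsTestFunction Ω (fun z => (g z : ℂ)) := by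
      have hsub : tsupport (fun z => (g z : ℂ)) ⊆ tsupport g :=
        closure_mono fun z hz h => hz (by simp [h])
      exact ⟨Complex.ofRealCLM.contDiff.comp hg, hgc.of_isClosed_subset (isClosed_tsupport _) hsub,
        hsub.trans hgs⟩
    have h1 := (Submodule.mem_orthogonal _ _).1 hf _ hu.toLp_mem_domain
    have h2 : ∀ z ∉ punctured Ω, g z = 0 := fun z hz =>
      image_eq_zero_of_notMem_tsupport fun h => hz (hgs h)
    have h3 : ∫ z, g z • f z = ∫ z in punctured Ω, g z • f z :=
      (setIntegral_eq_integral_of_forall_compl_eq_zero fun z hz => by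
        rw [h2 z hz, zero_smul]).symm
    rw [h3, ← h1, L2.inner_def]
    refine integral_congr_ae ?_
    filter_upwards [hu.memLp.coeFn_toLp] with z hz
    rw [hz, RCLike.inner_apply, Complex.conj_ofReal, mul_comm, Complex.real_smul]

lemma isFormalAdjoint_minimalOperator (Ω : Set ℂ) :
    (minimalOperator Ω).IsFormalAdjoint (minimalOperator Ω) := by
  intro x y
  have hmem : ∀ x : (minimalOperator Ω).domain,
      ((x : L2 Ω), minimalOperator Ω x) ∈ minimalGraph Ω := fun x => by
    rw [← minimalOperator_graph]
    exact LinearPMap.mem_graph _ x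
  obtain ⟨u, hu, hx1, hx2⟩ := hmem x
  obtain ⟨v, hv, hy1, hy2⟩ := hmem y
  have e1 := inner_eq_integral hx2 hy1 fun z hz => by
    rw [image_eq_zero_of_notMem_tsupport fun h => hz (hv.support_subset h), mul_zero]
  have e2 := inner_eq_integral hx1 hy2 fun z hz => by
    rw [image_eq_zero_of_notMem_tsupport fun h => hz (hu.support_subset h), map_zero, zero_mul]
  have cc : ∀ {w : ℂ → ℂ}, IsTestFunction Ω w → Continuous (fun z => conj (w z)) := fun hw =>
    Complex.continuous_conj.comp hw.smooth.continuous
  have pu₁ := hu.momentum 1 fun _ => contDiffAt_A₁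
  have pu₂ := hu.momentum Complex.I fun _ => contDiffAt_A₂
  have pv₁ := hv.momentum 1 fun _ => contDiffAt_A₁
  have pv₂ := hv.momentum Complex.I fun _ => contDiffAt_A₂
  have qu₁ := pu₁.momentum 1 fun _ => contDiffAt_A₁
  have qu₂ := pu₂.momentum Complex.I fun _ => contDiffAt_A₂
  have qv₁ := pv₁.momentum 1 fun _ => contDiffAt_A₁
  have qv₂ := pv₂.momentum Complex.I fun _ => contDiffAt_A₂
  rw [e1, e2]
  simp only [magneticLaplacian, map_add, add_mul, mul_add]
  rw [integral_add (hv.integrable_mul (cc qu₁)) (hv.integrable_mul (cc qu₂)),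
    integral_add (qv₁.integrable_mul (cc hu)) (qv₂.integrable_mul (cc hu)),
    integral_momentum pu₁ hv 1 fun _ => contDiffAt_A₁,
    integral_momentum hu pv₁ 1 fun _ => contDiffAt_A₁,
    integral_momentum pu₂ hv Complex.I fun _ => contDiffAt_A₂,
    integral_momentum hu pv₂ Complex.I fun _ => contDiffAt_A₂]

end Minimal

/-! ### Antilinear symmetries of the magnetic Laplacian -/

section Symmetry

/-- The condition under which `u ↦ m * conj (u ∘ L)` commutes up to sign with the momentum operator
`D_e - A`: the isometry `L` maps `e` to `s e` with `s = ±1`, and the gauge function `m` satisfies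
`D_e m = (A + s A ∘ L) m`. -/
def IsGauge (m : ℂ → ℂ) (L : ℂ ≃ₗᵢ[ℝ] ℂ) (e : ℂ) (A : ℂ → ℝ) : Prop :=
  ∃ s : ℝ, s ^ 2 = 1 ∧ L e = s • e ∧
    ∀ z, z ≠ 0 → -Complex.I * fderiv ℝ m z e = (A z + s * A (L z)) * m z

/-- The data of an antilinear symmetry `u ↦ m * conj (u ∘ L)` of the magnetic Laplacian on the
punctured domain, with an isometric involution `L` and a unimodular function `m` which is smooth
away from the origin. The condition `cocycle` makes the symmetry an involution. -/
structure IsMagneticSymmetry (Ω : Set ℂ) (m : ℂ → ℂ) (L : ℂ ≃ₗᵢ[ℝ] ℂ) : Prop where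
  image_eq : L '' Ω = Ω
  involutive : ∀ z, L (L z) = z
  norm_eq : ∀ z, ‖m z‖ = 1
  cocycle : ∀ z, z ≠ 0 → m z * conj (m (L z)) = 1
  smooth : ∀ z, z ≠ 0 → ContDiffAt ℝ ∞ m z
  gauge₁ : IsGauge m L 1 A₁
  gauge₂ : IsGauge m L Complex.I A₂

/-- The function `m * conj (u ∘ L)`. -/
def twist (m : ℂ → ℂ) (L : ℂ ≃ₗᵢ[ℝ] ℂ) (u : ℂ → ℂ) (z : ℂ) : ℂ := m z * conj (u (L z))

variable {Ω : Set ℂ} {m : ℂ → ℂ} {L : ℂ ≃ₗᵢ[ℝ] ℂ}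

lemma hasFDerivAt_conj_comp {u : ℂ → ℂ} (hu : Differentiable ℝ u) (L : ℂ ≃ₗᵢ[ℝ] ℂ) (z : ℂ) :
    HasFDerivAt (fun z => conj (u (L z))) ((Complex.conjCLE : ℂ →L[ℝ] ℂ) ∘L
      (fderiv ℝ u (L z) ∘L (L.toContinuousLinearEquiv : ℂ →L[ℝ] ℂ))) z := by
  have h1 : HasFDerivAt (fun z => u (L z))
      (fderiv ℝ u (L z) ∘L (L.toContinuousLinearEquiv : ℂ →L[ℝ] ℂ)) z :=
    (hu (L z)).hasFDerivAt.comp z L.toContinuousLinearEquiv.hasFDerivAt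
  exact (Complex.conjCLE : ℂ →L[ℝ] ℂ).hasFDerivAt.comp z h1

lemma tsupport_twist_subset (u : ℂ → ℂ) : tsupport (twist m L u) ⊆ L ⁻¹' tsupport u := by
  refine closure_minimal (fun z hz => ?_) ((isClosed_tsupport u).preimage L.continuous)
  refine subset_tsupport u fun h => hz ?_
  simp [twist, h]

namespace IsMagneticSymmetry

variable (hL : IsMagneticSymmetry Ω m L)

include hL

lemma mem_punctured_iff {z : ℂ} : L z ∈ punctured Ω ↔ z ∈ punctured Ω := by
  have h : L z ∈ Ω ↔ z ∈ Ω := by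
    conv_lhs => rw [← hL.image_eq]
    exact L.injective.mem_set_image
  simp [punctured, h]

lemma isTestFunction_twist {u : ℂ → ℂ} (hu : IsTestFunction Ω u) :
    IsTestFunction Ω (twist m L u) := by
  have hsub := tsupport_twist_subset (m := m) (L := L) u
  refine ⟨contDiff_iff_contDiffAt.2 fun z => ?_, ?_, fun z hz => ?_⟩
  · by_cases hz : z = 0
    · have h0 : z ∉ tsupport (twist m L u) := fun h => by
        have := (hu.support_subset (hsub h)).2
        simp [hz] at this
      exact contDiffAt_const.congr_of_eventuallyEq (notMem_tsupport_iff_eventuallyEq.1 h0)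
    · refine (hL.smooth z hz).mul ?_
      exact (Complex.conjCLE.contDiff.comp
        (hu.smooth.comp L.toContinuousLinearEquiv.contDiff)).contDiffAt
  · exact (L.toHomeomorph.isCompact_preimage.2 hu.compact).of_isClosed_subset
      (isClosed_tsupport _) hsub
  · exact hL.mem_punctured_iff.1 (hu.support_subset (hsub hz))

/-- Conjugation turns `D_e - A` into `-(D_e + A)`, the isometry replaces `D_e` by `s D_e` and `A` by
`A ∘ L`, and the gauge function corrects the resulting potential. -/
lemma momentum_twist {u : ℂ → ℂ} (hu : IsTestFunction Ω u) {e : ℂ} {A : ℂ → ℝ} {s : ℝ}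
    (he : L e = s • e)
    (hA : ∀ z, z ≠ 0 → -Complex.I * fderiv ℝ m z e = (A z + s * A (L z)) * m z) :
    momentum e A (twist m L u) = (-s : ℂ) • twist m L (momentum e A u) := by
  ext z
  by_cases hz : z = 0
  · have h0 : (0 : ℂ) ∉ tsupport u := fun h => (hu.support_subset h).2 rfl
    have h1 : (0 : ℂ) ∉ tsupport (twist m L u) := fun h =>
      ((hL.isTestFunction_twist hu).support_subset h).2 rfl
    rw [hz, image_eq_zero_of_notMem_tsupport fun h => h1 (tsupport_momentum _ _ _ h), Pi.smul_apply,
      twist, map_zero, image_eq_zero_of_notMem_tsupport fun h => h0 (tsupport_momentum _ _ _ h)]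
    simp
  · have h1 := ((hL.smooth z hz).differentiableAt (by simp)).hasFDerivAt.mul
      (hasFDerivAt_conj_comp (hu.smooth.differentiable (by simp)) L z)
    have h2 : fderiv ℝ (twist m L u) z e =
        m z * (s * conj (fderiv ℝ u (L z) e)) + conj (u (L z)) * fderiv ℝ m z e := by
      rw [show twist m L u = m * fun z => conj (u (L z)) from rfl, h1.fderiv]
      have h3 : fderiv ℝ u (L z) (s • e) = s • fderiv ℝ u (L z) e := map_smul _ _ _
      simp [he, h3, -Complex.real_smul]
      simp only [Complex.real_smul]
      ring
    simp only [momentum, Pi.smul_apply, twist, smul_eq_mul, map_sub, map_mul, map_neg,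
      Complex.conj_I, Complex.conj_ofReal]
    rw [h2]
    linear_combination conj (u (L z)) * hA z hz

lemma momentum_momentum_twist {u : ℂ → ℂ} (hu : IsTestFunction Ω u) {e : ℂ} {A : ℂ → ℝ}
    (hA : ∀ z, z ≠ 0 → ContDiffAt ℝ ∞ A z) (hg : IsGauge m L e A) :
    momentum e A (momentum e A (twist m L u)) = twist m L (momentum e A (momentum e A u)) := by
  obtain ⟨s, hs, he, hm⟩ := hg
  have hu' := hu.momentum e hA
  rw [hL.momentum_twist hu he hm,
    momentum_smul _ _ ((hL.isTestFunction_twist hu').smooth.differentiable (by simp)),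
    hL.momentum_twist hu' he hm, smul_smul, neg_mul_neg, ← sq, ← Complex.ofReal_pow, hs,
    Complex.ofReal_one, one_smul]

lemma magneticLaplacian_twist {u : ℂ → ℂ} (hu : IsTestFunction Ω u) :
    magneticLaplacian (twist m L u) = twist m L (magneticLaplacian u) := by
  ext z
  rw [magneticLaplacian, hL.momentum_momentum_twist hu (fun _ => contDiffAt_A₁) hL.gauge₁,
    hL.momentum_momentum_twist hu (fun _ => contDiffAt_A₂) hL.gauge₂]
  simp [twist, magneticLaplacian, mul_add]

lemma measurePreserving :
    MeasurePreserving L (volume.restrict (punctured Ω)) (volume.restrict (punctured Ω)) :=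
  measurePreserving_of_image L hL.image_eq

lemma twist_ae_eq {u v : ℂ → ℂ} (h : u =ᵐ[volume.restrict (punctured Ω)] v) :
    twist m L u =ᵐ[volume.restrict (punctured Ω)] twist m L v := by
  filter_upwards [hL.measurePreserving.quasiMeasurePreserving.ae_eq_comp h] with z hz
  exact congrArg (fun w => m z * conj w) hz

end IsMagneticSymmetry

lemma ae_ne_zero (Ω : Set ℂ) : ∀ᵐ z ∂volume.restrict (punctured Ω), z ≠ 0 :=
  ae_restrict_of_ae (Measure.ae_ne volume 0)

/-- The real linear operator `W` on `L²` acts as the symmetry `u ↦ m * conj (u ∘ L)`. -/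
def Implements {Ω : Set ℂ} (W : L2 Ω →ₗ[ℝ] L2 Ω) (m : ℂ → ℂ) (L : ℂ ≃ₗᵢ[ℝ] ℂ) : Prop :=
  ∀ u : L2 Ω, W u =ᵐ[volume.restrict (punctured Ω)] twist m L u

namespace Implements

variable {W : L2 Ω →ₗ[ℝ] L2 Ω} (hW : Implements W m L) (hL : IsMagneticSymmetry Ω m L)

include hW hL

lemma map_smul_conj (c : ℂ) (x : L2 Ω) : W (c • x) = conj c • W x := by
  refine Lp.ext ?_
  filter_upwards [hW (c • x), Lp.coeFn_smul (conj c) (W x), hW x,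
    hL.twist_ae_eq (Lp.coeFn_smul c x)] with z h1 h2 h3 h4
  rw [h1, h2, h4, Pi.smul_apply, h3]
  simp only [twist, Pi.smul_apply, smul_eq_mul, map_mul]
  ring

lemma apply_apply (x : L2 Ω) : W (W x) = x := by
  refine Lp.ext ?_
  filter_upwards [hW (W x), hL.twist_ae_eq (hW x), ae_ne_zero Ω] with z h1 h2 hz
  rw [h1, h2, twist, twist, map_mul, Complex.conj_conj, hL.involutive, ← mul_assoc,
    hL.cocycle z hz, one_mul]

lemma inner_map (x y : L2 Ω) : inner ℂ (W x) (W y) = inner ℂ y x := by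
  rw [L2.inner_def, L2.inner_def, ← hL.measurePreserving.integral_comp
    L.toHomeomorph.measurableEmbedding fun z => inner ℂ (y z) (x z)]
  refine integral_congr_ae ?_
  filter_upwards [hW x, hW y] with z h1 h2
  have h3 : m z * conj (m z) = 1 := by
    rw [Complex.mul_conj, Complex.normSq_eq_norm_sq, hL.norm_eq]
    simp
  rw [h1, h2, RCLike.inner_apply, RCLike.inner_apply, twist, twist, map_mul, Complex.conj_conj]
  linear_combination (conj (y (L z)) * x (L z)) * h3

lemma isConjugation : IsConjugation W :=
  ⟨hW.map_smul_conj hL, hW.apply_apply hL, hW.inner_map hL⟩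

lemma graph_minimalOperator (x y : L2 Ω) (h : (x, y) ∈ (minimalOperator Ω).graph) :
    (W x, W y) ∈ (minimalOperator Ω).graph := by
  rw [minimalOperator_graph] at h ⊢
  obtain ⟨u, hu, h1, h2⟩ := h
  refine ⟨twist m L u, hL.isTestFunction_twist hu, (hW x).trans (hL.twist_ae_eq h1), ?_⟩
  rw [hL.magneticLaplacian_twist hu]
  exact (hW y).trans (hL.twist_ae_eq h2)

lemma graph_abOperator (hΩ : IsOpen Ω) (x y : L2 Ω) (h : (x, y) ∈ (abOperator Ω).graph) :
    (W x, W y) ∈ (abOperator Ω).graph :=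
  (hW.isConjugation hL).graph_friedrichs _ (dense_domain_minimalOperator hΩ)
    (hW.graph_minimalOperator hL) x y h

/-- Two symmetries with commuting isometries commute up to a sign. -/
lemma comp_apply_eq {W' : L2 Ω →ₗ[ℝ] L2 Ω} {m' : ℂ → ℂ} {L' : ℂ ≃ₗᵢ[ℝ] ℂ}
    (hW' : Implements W' m' L') (hL' : IsMagneticSymmetry Ω m' L') (c : ℝ)
    (hLL' : ∀ z, L (L' z) = L' (L z))
    (hm : ∀ z, z ≠ 0 → m z * conj (m' (L z)) = c * (m' z * conj (m (L' z)))) (x : L2 Ω) :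
    W (W' x) = c • W' (W x) := by
  refine Lp.ext ?_
  filter_upwards [hW (W' x), hL.twist_ae_eq (hW' x), hW' (W x), hL'.twist_ae_eq (hW x),
    Lp.coeFn_smul c (W' (W x)), ae_ne_zero Ω] with z h1 h2 h3 h4 h5 hz
  rw [h1, h2, h5, Pi.smul_apply, h3, h4, Complex.real_smul]
  simp only [twist, map_mul, Complex.conj_conj, hLL']
  linear_combination (x (L' (L z))) * hm z hz

end Implements

end Symmetry

/-! ### The symmetries `K`, `Σ₁ᶜ` and `Σ₂ᶜ` -/

section Concrete

variable {Ω : Set ℂ}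

/-- The reflection `σ₁` as a linear isometry. -/
def reflection₁ : ℂ ≃ₗᵢ[ℝ] ℂ := Complex.conjLIE.trans (LinearIsometryEquiv.neg ℝ)

lemma reflection₁_apply (z : ℂ) : reflection₁ z = -conj z := rfl

lemma coe_reflection₁ : ⇑reflection₁ = σ₁ := by
  ext z
  apply Complex.ext <;> simp [σ₁, reflection₁_apply]

lemma coe_conjLIE : ⇑Complex.conjLIE = σ₂ := by
  ext z
  apply Complex.ext <;> simp [σ₂]

lemma norm_phase (z : ℂ) : ‖phase z‖ = 1 := Complex.norm_exp_ofReal_mul_I _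

lemma phase_eq {z : ℂ} (hz : z ≠ 0) : phase z = z / ‖z‖ := by
  rw [eq_div_iff (by simpa using hz), mul_comm]
  exact Complex.norm_mul_exp_arg_mul_I z

lemma phase_conj {z : ℂ} (hz : z ≠ 0) : phase (conj z) = conj (phase z) := by
  rw [phase_eq hz, phase_eq ((map_ne_zero (starRingEnd ℂ)).2 hz)]
  simp

lemma phase_neg {z : ℂ} (hz : z ≠ 0) : phase (-z) = -phase z := by
  rw [phase_eq hz, phase_eq (neg_ne_zero.2 hz), norm_neg, neg_div]

lemma contDiffAt_phase {z : ℂ} (hz : z ≠ 0) : ContDiffAt ℝ ∞ phase z := by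
  have h1 : ContDiffAt ℝ ∞ (fun w : ℂ => ‖w‖⁻¹ • w) z :=
    ((contDiffAt_norm ℝ hz).inv (norm_ne_zero_iff.2 hz)).smul contDiffAt_id
  refine h1.congr_of_eventuallyEq ?_
  filter_upwards [isOpen_ne.mem_nhds hz] with w hw
  rw [phase_eq hw, Complex.real_smul, Complex.ofReal_inv, div_eq_inv_mul]

lemma phase_sq_mul_conj {z : ℂ} (hz : z ≠ 0) : phase z ^ 2 * conj z = z := by
  have h : (‖z‖ : ℂ) ≠ 0 := by simpa using hz
  rw [phase_eq hz, div_pow, div_mul_eq_mul_div, div_eq_iff (pow_ne_zero 2 h), sq, mul_assoc,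
    Complex.mul_conj, Complex.normSq_eq_norm_sq]
  simp

/-- The derivative of `θ` in the direction `e` is `Im (e z̄) / |z|²`; for `e = 1` and `e = i` these are
the components of `2 A`, so that `exp (i θ)` is the gauge function that turns `-A` into `A`. -/
lemma fderiv_phase {z : ℂ} (hz : z ≠ 0) (e : ℂ) :
    -Complex.I * fderiv ℝ phase z e = ((e * conj z).im / ‖z‖ ^ 2 : ℝ) * phase z := by
  have hc : conj z ≠ 0 := by simpa using hz
  have hd := ((contDiffAt_phase hz).differentiableAt (by simp)).hasFDerivAt
  -- differentiate the relation `phase z ^ 2 * conj z = z`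
  have h1 := (hd.mul hd).mul (Complex.conjCLE : ℂ →L[ℝ] ℂ).hasFDerivAt
  have h2 : HasFDerivAt (fun w : ℂ => w) (ContinuousLinearMap.id ℝ ℂ) z := hasFDerivAt_id z
  have h3 := h1.unique (h2.congr_of_eventuallyEq ?_)
  · have h4 := congrArg (fun T : ℂ →L[ℝ] ℂ => T e) h3
    simp only [add_apply, smul_apply, Pi.mul_apply, ContinuousLinearEquiv.coe_coe,
      Complex.conjCLE_apply, smul_eq_mul, ContinuousLinearMap.id_apply] at h4
    have h5 := phase_sq_mul_conj hz
    have h6 : ((e * conj z).im : ℂ) * (2 * Complex.I) = e * conj z - conj e * z := by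
      have := Complex.sub_conj (e * conj z)
      simp only [map_mul, Complex.conj_conj] at this
      rw [this]
      push_cast
      ring
    have h7 : ((‖z‖ : ℂ)) ^ 2 = z * conj z := by
      rw [Complex.mul_conj, Complex.normSq_eq_norm_sq]
      simp
    push_cast
    rw [h7, div_mul_eq_mul_div, eq_div_iff (mul_ne_zero hz hc)]
    linear_combination (-Complex.I / 2) * (phase z * conj z * h4 -
      (phase z * conj e + 2 * conj z * fderiv ℝ phase z e) * h5 - phase z * h6) -
      ((e * conj z).im : ℂ) * phase z * Complex.I_mul_I
  · filter_upwards [isOpen_ne.mem_nhds hz] with w hw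
    have := phase_sq_mul_conj hw
    rw [sq] at this
    exact this

lemma isMagneticSymmetry_K (Ω : Set ℂ) :
    IsMagneticSymmetry Ω phase (LinearIsometryEquiv.refl ℝ ℂ) where
  image_eq := by simp
  involutive z := rfl
  norm_eq := norm_phase
  cocycle z hz := by
    rw [LinearIsometryEquiv.coe_refl, id, Complex.mul_conj, Complex.normSq_eq_norm_sq, norm_phase]
    simp
  smooth z hz := contDiffAt_phase hz
  gauge₁ := by
    refine ⟨1, by simp, by simp, fun z hz => ?_⟩
    rw [fderiv_phase hz]
    simp only [A₁, LinearIsometryEquiv.coe_refl, id, one_mul, Complex.conj_im]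
    push_cast
    ring
  gauge₂ := by
    refine ⟨1, by simp, by simp, fun z hz => ?_⟩
    rw [fderiv_phase hz]
    simp only [A₂, LinearIsometryEquiv.coe_refl, id, Complex.I_mul_im, Complex.conj_re]
    push_cast
    ring

lemma isMagneticSymmetry_Sigma₁c (h₁ : σ₁ '' Ω = Ω) :
    IsMagneticSymmetry Ω (fun _ => Complex.I) reflection₁ where
  image_eq := by rwa [coe_reflection₁]
  involutive z := by simp [reflection₁_apply]
  norm_eq z := by simp
  cocycle z hz := by simp
  smooth z hz := contDiffAt_const
  gauge₁ := ⟨-1, by simp, by simp [reflection₁_apply], fun z hz => by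
    simp [A₁, reflection₁_apply]⟩
  gauge₂ := ⟨1, by simp, by simp [reflection₁_apply], fun z hz => by
    simp [A₂, reflection₁_apply]
    ring⟩

lemma isMagneticSymmetry_Sigma₂c (h₂ : σ₂ '' Ω = Ω) :
    IsMagneticSymmetry Ω (fun _ => 1) Complex.conjLIE where
  image_eq := by rwa [coe_conjLIE]
  involutive z := by simp
  norm_eq z := by simp
  cocycle z hz := by simp
  smooth z hz := contDiffAt_const
  gauge₁ := ⟨1, by simp, by simp, fun z hz => by
    simp [A₁]
    ring⟩
  gauge₂ := ⟨-1, by simp, by simp, fun z hz => by simp [A₂]⟩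

lemma coeFn_conjugation (u : L2 Ω) :
    conjugation Ω u =ᵐ[volume.restrict (punctured Ω)] fun z => conj (u z) :=
  ContinuousLinearMap.coeFn_compLp (Complex.conjCLE : ℂ →L[ℝ] ℂ) u

lemma implements_K (Ω : Set ℂ) : Implements (K Ω) phase (LinearIsometryEquiv.refl ℝ ℂ) := by
  intro u
  filter_upwards [(memLp_phase_mul (conjugation Ω u)).coeFn_toLp, coeFn_conjugation u] with z h1 h2
  rw [twist, LinearIsometryEquiv.coe_refl, id, ← h2]
  exact h1

lemma implements_Sigma₁c (h₁ : σ₁ '' Ω = Ω) :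
    Implements (Sigma₁c h₁) (fun _ => Complex.I) reflection₁ := by
  intro u
  filter_upwards [Lp.coeFn_smul Complex.I (conjugation Ω (Sigma₁ h₁ u)),
    coeFn_conjugation (Sigma₁ h₁ u),
    Lp.coeFn_compMeasurePreserving u (measurePreserving_σ₁ h₁)] with z h1 h2 h3
  rw [twist, coe_reflection₁]
  refine h1.trans ?_
  rw [Pi.smul_apply, h2, smul_eq_mul]
  exact congrArg (fun w => Complex.I * conj w) h3

lemma implements_Sigma₂c (h₂ : σ₂ '' Ω = Ω) :
    Implements (Sigma₂c h₂) (fun _ => 1) Complex.conjLIE := by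
  intro u
  filter_upwards [coeFn_conjugation (Sigma₂ h₂ u),
    Lp.coeFn_compMeasurePreserving u (measurePreserving_σ₂ h₂)] with z h2 h3
  rw [twist, coe_conjLIE, one_mul]
  refine h2.trans ?_
  exact congrArg (fun w => conj w) h3

lemma K_Sigma₁c (h₁ : σ₁ '' Ω = Ω) (u : L2 Ω) : K Ω (Sigma₁c h₁ u) = Sigma₁c h₁ (K Ω u) := by
  have := (implements_K Ω).comp_apply_eq (isMagneticSymmetry_K Ω) (implements_Sigma₁c h₁)
    (isMagneticSymmetry_Sigma₁c h₁) 1 (fun z => rfl) (fun z hz => ?_) u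
  · rwa [one_smul] at this
  · rw [reflection₁_apply, phase_neg ((map_ne_zero (starRingEnd ℂ)).2 hz), phase_conj hz]
    simp [mul_comm]

lemma K_Sigma₂c (h₂ : σ₂ '' Ω = Ω) (u : L2 Ω) : K Ω (Sigma₂c h₂ u) = Sigma₂c h₂ (K Ω u) := by
  have := (implements_K Ω).comp_apply_eq (isMagneticSymmetry_K Ω) (implements_Sigma₂c h₂)
    (isMagneticSymmetry_Sigma₂c h₂) 1 (fun z => rfl) (fun z hz => ?_) u
  · rwa [one_smul] at this
  · rw [Complex.conjLIE_apply, phase_conj hz]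
    simp

lemma Sigma₁c_Sigma₂c (h₁ : σ₁ '' Ω = Ω) (h₂ : σ₂ '' Ω = Ω) (u : L2 Ω) :
    Sigma₁c h₁ (Sigma₂c h₂ u) = -Sigma₂c h₂ (Sigma₁c h₁ u) := by
  have := (implements_Sigma₁c h₁).comp_apply_eq (isMagneticSymmetry_Sigma₁c h₁)
    (implements_Sigma₂c h₂) (isMagneticSymmetry_Sigma₂c h₂) (-1)
    (fun z => by simp [reflection₁_apply]) (fun z hz => by simp) u
  rwa [neg_one_smul] at this

/-- The symmetry that does not enter the definition of `V` takes the role of `J'` in `decomposition`,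
and in the antisymmetric cases `J` is the negative of the other one. -/
lemma nonempty_decomposition (hΩ : IsOpen Ω) (h₁ : σ₁ '' Ω = Ω) (h₂ : σ₂ '' Ω = Ω)
    {V : Submodule ℝ (L2 Ω)}
    (hV : V = L2KSigma₁ h₁ ∨ V = L2KaSigma₁ h₁ ∨ V = L2KSigma₂ h₂ ∨ V = L2KaSigma₂ h₂) :
    Nonempty (Decomposition (abOperator Ω) V (Fin 4)) := by
  have hK := (implements_K Ω).isConjugation (isMagneticSymmetry_K Ω)
  have hS₁ := (implements_Sigma₁c h₁).isConjugation (isMagneticSymmetry_Sigma₁c h₁)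
  have hS₂ := (implements_Sigma₂c h₂).isConjugation (isMagneticSymmetry_Sigma₂c h₂)
  have tK := (implements_K Ω).graph_abOperator (isMagneticSymmetry_K Ω) hΩ
  have tS₁ := (implements_Sigma₁c h₁).graph_abOperator (isMagneticSymmetry_Sigma₁c h₁) hΩ
  have tS₂ := (implements_Sigma₂c h₂).graph_abOperator (isMagneticSymmetry_Sigma₂c h₂) hΩ
  have hS₂₁ : ∀ u, Sigma₂c h₂ (Sigma₁c h₁ u) = -Sigma₁c h₁ (Sigma₂c h₂ u) := fun u => by
    rw [Sigma₁c_Sigma₂c, neg_neg]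
  have hn₁ : ∀ u, K Ω ((-Sigma₁c h₁) u) = (-Sigma₁c h₁) (K Ω u) := fun u => by
    simp only [LinearMap.neg_apply, map_neg, K_Sigma₁c]
  have hn₂ : ∀ u, K Ω ((-Sigma₂c h₂) u) = (-Sigma₂c h₂) (K Ω u) := fun u => by
    simp only [LinearMap.neg_apply, map_neg, K_Sigma₂c]
  have hn₁₂ : ∀ u, (-Sigma₁c h₁) (Sigma₂c h₂ u) = -Sigma₂c h₂ ((-Sigma₁c h₁) u) := fun u => by
    simp only [LinearMap.neg_apply, map_neg, Sigma₁c_Sigma₂c h₁ h₂]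
  have hn₂₁ : ∀ u, (-Sigma₂c h₂) (Sigma₁c h₁ u) = -Sigma₁c h₁ ((-Sigma₂c h₂) u) := fun u => by
    simp only [LinearMap.neg_apply, map_neg, hS₂₁]
  have hneg : ∀ x y : L2 Ω, -x = y ↔ x = -y := fun x y => neg_eq_iff_eq_neg
  rcases hV with rfl | rfl | rfl | rfl
  · exact ⟨decomposition hK hS₁ hS₂ (K_Sigma₁c h₁) (K_Sigma₂c h₂) (Sigma₁c_Sigma₂c h₁ h₂) tK tS₁ tS₂
      fun x => Iff.rfl⟩
  · exact ⟨decomposition hK hS₁.neg hS₂ hn₁ (K_Sigma₂c h₂)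
      hn₁₂ tK
      (fun x y h => (abOperator Ω).graph.neg_mem (tS₁ x y h)) tS₂
      fun x => and_congr_right fun _ => (hneg _ _).symm⟩
  · exact ⟨decomposition hK hS₂ hS₁ (K_Sigma₂c h₂) (K_Sigma₁c h₁) hS₂₁ tK tS₂ tS₁
      fun x => Iff.rfl⟩
  · exact ⟨decomposition hK hS₂.neg hS₁ hn₂ (K_Sigma₁c h₁)
      hn₂₁ tK
      (fun x y h => (abOperator Ω).graph.neg_mem (tS₂ x y h)) tS₁
      fun x => and_congr_right fun _ => (hneg _ _).symm⟩

end Concrete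

end AharonovBohm

end

open AharonovBohm in
theorem proposition5p3 (Ω : Set ℂ) (hΩ : IsOpen Ω) (h₁ : σ₁ '' Ω = Ω) (h₂ : σ₂ '' Ω = Ω)
    (V : Submodule ℝ (L2 Ω))
    (hV : V = L2KSigma₁ h₁ ∨ V = L2KaSigma₁ h₁ ∨ V = L2KSigma₂ h₂ ∨ V = L2KaSigma₂ h₂) :
    (∀ u : (abOperator Ω).domain, (u : L2 Ω) ∈ V → abOperator Ω u ∈ V) ∧
    spectrumOf (abOperator Ω) = Complex.ofReal '' spectrumOf (restrictTo (abOperator Ω) V) ∧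
    ∀ (c : ℝ) (k : Cardinal), multiplicityOf (restrictTo (abOperator Ω) V) c = k ↔
      multiplicityOf (abOperator Ω) (c : ℂ) = 2 * k := by
  obtain ⟨d⟩ := nonempty_decomposition hΩ h₁ h₂ hV
  refine ⟨d.apply_mem, ?_, fun c k => ?_⟩
  · ext z
    constructor
    · intro hz
      have him : z.im = 0 := by
        by_contra him
        exact hz (isResolventPoint_friedrichs _ (dense_domain_minimalOperator hΩ)
          (isFormalAdjoint_minimalOperator Ω) him)
      obtain ⟨c, rfl⟩ : ∃ c : ℝ, (c : ℂ) = z := ⟨z.re, Complex.ext rfl him.symm⟩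
      exact ⟨c, fun h => hz ((d.isResolventPoint_iff c).2 h), rfl⟩
    · rintro ⟨c, hc, rfl⟩
      exact fun h => hc ((d.isResolventPoint_iff c).1 h)
  · have h : multiplicityOf (abOperator Ω) (c : ℂ) =
        2 * multiplicityOf (restrictTo (abOperator Ω) V) c := by
      refine cardinal_two_mul_cancel ?_
      rw [d.two_mul_multiplicityOf, ← mul_assoc, Fintype.card_fin]
      congr 1
      norm_num
    rw [h]
    exact ⟨fun e => by rw [e], cardinal_two_mul_cancel⟩
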